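/- Conventions. Let $K$ be a field, $m\ge 1$, $A=[a_{i,j}]\in K[X]^{m\times m}$ and $s\in\mathbb Z^m$. The degree $\deg(A)$ of a nonzero matrix is the maximum of the degrees of its entries, and the generic determinant bound is $\sigma(A)=\max_{\pi\in S_m}\sum_{i=1}^m\overline{\deg}(a_{i,\pi(i)})$, where $\overline{\deg}(0)=0$ and $\overline{\deg}(p)=\deg p$ for $p\ne0$. The $s$-degree of a row $p=[p_1,\dots,p_m]$ is $\max_j(\deg p_j+s_j)$, and the $s$-pivot index of a nonzero row $p$ is the largest $j$ at which this maximum is attained; $p_j$ is then the $s$-pivot entry. The $s$-leading matrix of $P$, whose rows have $s$-degrees $d_1,\dots,d_m$, has as entry $(i,j)$ the coefficient of degree $d_i-s_j$ of $P_{i,j}$; a nonsingular $P$ is $s$-reduced if its $s$-leading matrix is nonsingular. It is in $s$-Popov form if the $s$-pivot indices of its rows are strictly increasing, the pivot entries are monic, and in each column containing a pivot all other entries have degree less than the pivot entry. The $s$-Popov form of a nonsingular $A$ is the unique $s$-reduced matrix in $s$-Popov form whose rows generate the same $K[X]$-module as the rows of $A$. Proposition 3.2. Let $A\in K[X]^{m\times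 m}$ be nonsingular and let $s\in\mathbb Z^m$. With no field operation, one can build from $A$ and $s$ a nonsingular matrix $\tilde A\in K[X]^{\tilde m\times\tilde m}$ and a shift $u\in\mathbb Z^{\tilde m}$ such that $m\le\tilde m\le 3m$, $\deg(\tilde A)\le\lceil\sigma(A)/m\rceil$, and the $s$-Popov form of $A$ is the leading principal $m\times m$ submatrix of the $u$-Popov form of $\tilde A$. Here "with no field operation, one can build" means the following. There is a single computable function, independent of $K$, which from the degrees $\overline{\deg}(a_{i,j})$ and the shift $s$ computes $\tilde m$, $u$, and a straight-line program (whose operands are the constants $0,1,-1$, the coefficients of the entries of $A$, and the results of earlier steps, and whose steps are additions, subtractions, multiplications and divisions in $K$) with a designation of its operands as the coefficients of the entries of $\tilde A$; and this program has no step at all. -/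

import Mathlib

open Polynomial

noncomputable section

namespace PolyMat

/-! ### Shifted degrees, reduced forms, Popov forms -/

section Popov

variable {K : Type*} [Field K] {m n : ℕ}

/-- The `s`-degree `max_j (deg p_j + s_j)` of a row `p`; it is `⊥` exactly for the zero row
(when there is a column at all). -/
def shiftedDegree (s : Fin n → ℤ) (p : Fin n → K[X]) : WithBot ℤ :=
  Finset.univ.sup fun j => (p j).degree.map (fun d : ℕ => (d : ℤ)) + (s j : WithBot ℤ)

/-- The `s`-leading matrix: its entry `(i, j)` is the coefficient of degree `d_i - s_j` of `P i j`,
where `d_i` is the `s`-degree of row `i` (zero if that exponent is negative, and on zero rows). -/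
def leadingMatrix (s : Fin n → ℤ) (P : Matrix (Fin m) (Fin n) K[X]) : Matrix (Fin m) (Fin n) K :=
  Matrix.of fun i j =>
    let d : ℤ := (shiftedDegree s (P.row i)).unbotD 0
    if s j ≤ d then (P i j).coeff (d - s j).toNat else 0

/-- `P` is `s`-reduced: `P` and its `s`-leading matrix have full (row) rank. -/
def IsReduced (s : Fin n → ℤ) (P : Matrix (Fin m) (Fin n) K[X]) : Prop :=
  LinearIndependent K[X] P.row ∧ LinearIndependent K (leadingMatrix s P).row

/-- `j` is the `s`-pivot index of the nonzero row `p`: the largest index at which the `s`-degree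
of `p` is attained. -/
def IsPivotIndex (s : Fin n → ℤ) (p : Fin n → K[X]) (j : Fin n) : Prop :=
  p ≠ 0 ∧
  IsGreatest {k : Fin n |
    shiftedDegree s p = (p k).degree.map (fun d : ℕ => (d : ℤ)) + (s k : WithBot ℤ)} j

/-- `P` is in `s`-Popov form: it has full rank, the `s`-pivot indices of its rows are strictly
increasing, the pivot entries are monic, and every other entry of a column which contains a pivot
has degree less than that pivot. -/
def IsPopov (s : Fin n → ℤ) (P : Matrix (Fin m) (Fin n) K[X]) : Prop :=
  LinearIndependent K[X] P.row ∧
  ∃ piv : Fin m → Fin n, StrictMono piv ∧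
    ∀ i, IsPivotIndex s (P.row i) (piv i) ∧ (P i (piv i)).Monic ∧
      ∀ i', i' ≠ i → (P i' (piv i)).degree < (P i (piv i)).degree

/-- The row space: the `K[X]`-module generated by the rows. -/
def rowSpace (P : Matrix (Fin m) (Fin n) K[X]) : Submodule K[X] (Fin n → K[X]) :=
  Submodule.span K[X] (Set.range P.row)

/-- `P` is an `s`-reduced form of `A`, and `P` is in `s`-Popov form. -/
def IsPopovFormOf (s : Fin n → ℤ) (A P : Matrix (Fin m) (Fin n) K[X]) : Prop :=
  rowSpace P = rowSpace A ∧ IsReduced s P ∧ IsPopov s P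

/-- The generic bound `σ(A) = max_π ∑_i deg' a_{i,π(i)}` on the degree of the determinant, where
`deg'` is the degree with `deg' 0 = 0`. -/
def genericDetBound (A : Matrix (Fin m) (Fin m) K[X]) : ℕ :=
  Finset.univ.sup fun π : Equiv.Perm (Fin m) => ∑ i, (A i (π i)).natDegree

/-- The degree of a matrix: the maximum of the degrees of its entries (`0` if there is no nonzero
entry). -/
def matDegree (A : Matrix (Fin m) (Fin n) K[X]) : ℕ :=
  Finset.univ.sup fun ij : Fin m × Fin n => (A ij.1 ij.2).natDegree

end Popov

/-! ### Straight-line constructions over a field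

A construction reads the coefficients of a polynomial matrix `A`, performs a list of field
operations, and assembles a new polynomial matrix, given by the lists of the coefficients of its
entries, and a shift. Its cost is the number of the field operations. It is itself a finite
combinatorial object, which mentions no field. -/

/-- The four field operations. -/
inductive FieldOp
  | add | sub | mul | div

/-- What is available without computation: the constants `0`, `1`, `-1`, the coefficient of `X ^ k`
in the entry `(i, j)` of the input (indices start at `0`), and the result of an earlier step. -/
inductive Operand
  | zero | one | negOne
  | coeff (i j k : ℕ)
  | result (r : ℕ)

/-- One step of a straight-line program: a field operation on two operands. -/
structure Step where
  op : FieldOp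
  fst : Operand
  snd : Operand

/-- A straight-line construction of a `dim × dim` polynomial matrix and of a shift:
`entries[i][j][k]` is the coefficient of `X ^ k` in the entry `(i, j)`. -/
structure Construction where
  steps : List Step
  dim : ℕ
  shift : List ℤ
  entries : List (List (List Operand))

/-- The codings of these finite objects (needed only to speak of computable functions). -/
def FieldOp.equiv : FieldOp ≃ Fin 4 where
  toFun | .add => 0 | .sub => 1 | .mul => 2 | .div => 3
  invFun | 0 => .add | 1 => .sub | 2 => .mul | 3 => .div
  left_inv x := by cases x <;> rfl
  right_inv x := by fin_cases x <;> rfl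

def Operand.equiv : Operand ≃ (Fin 3 ⊕ (ℕ × ℕ × ℕ)) ⊕ ℕ where
  toFun
    | .zero => .inl (.inl 0) | .one => .inl (.inl 1) | .negOne => .inl (.inl 2)
    | .coeff i j k => .inl (.inr (i, j, k))
    | .result r => .inr r
  invFun
    | .inl (.inl 0) => .zero | .inl (.inl 1) => .one | .inl (.inl 2) => .negOne
    | .inl (.inr (i, j, k)) => .coeff i j k
    | .inr r => .result r
  left_inv x := by cases x <;> rfl
  right_inv x := by
    rcases x with (x | x) | x
    · fin_cases x <;> rfl
    · rfl
    · rfl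

def Step.equiv : Step ≃ FieldOp × Operand × Operand where
  toFun t := (t.op, t.fst, t.snd)
  invFun t := ⟨t.1, t.2.1, t.2.2⟩

def Construction.equiv :
    Construction ≃ List Step × ℕ × List ℤ × List (List (List Operand)) where
  toFun c := (c.steps, c.dim, c.shift, c.entries)
  invFun c := ⟨c.1, c.2.1, c.2.2.1, c.2.2.2⟩

instance : Primcodable FieldOp := Primcodable.ofEquiv _ FieldOp.equiv
instance : Primcodable Operand := Primcodable.ofEquiv _ Operand.equiv
instance : Primcodable Step := Primcodable.ofEquiv _ Step.equiv
instance : Primcodable Construction := Primcodable.ofEquiv _ Construction.equiv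

section Run

variable {K : Type*} [Field K] {m : ℕ}

def FieldOp.apply : FieldOp → K → K → K
  | .add, x, y => x + y
  | .sub, x, y => x - y
  | .mul, x, y => x * y
  | .div, x, y => x / y

/-- The value of an operand on the input `A`, given the results of the earlier steps (`0` for an
index that is out of range). -/
def Operand.value (A : Matrix (Fin m) (Fin m) K[X]) (results : List K) : Operand → K
  | .zero => 0
  | .one => 1
  | .negOne => -1
  | .coeff i j k => if h : i < m ∧ j < m then (A ⟨i, h.1⟩ ⟨j, h.2⟩).coeff k else 0
  | .result r => results.getD r 0

/-- The results of the steps, in order, on the input `A`. -/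
def runSteps (A : Matrix (Fin m) (Fin m) K[X]) (steps : List Step) : List K :=
  steps.foldl
    (fun results t =>
      results ++ [t.op.apply (t.fst.value A results) (t.snd.value A results)]) []

/-- The polynomial with a given list of coefficients, from degree `0` upwards. -/
def ofCoeffs (l : List K) : K[X] :=
  ∑ k ∈ Finset.range l.length, C (l.getD k 0) * X ^ k

/-- The number of field operations that a construction performs. -/
def Construction.fieldOpCount (c : Construction) : ℕ := c.steps.length

/-- The matrix that a construction builds from the input `A`. -/
def Construction.matrix (c : Construction) (A : Matrix (Fin m) (Fin m) K[X]) :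
    Matrix (Fin c.dim) (Fin c.dim) K[X] :=
  Matrix.of fun i j =>
    ofCoeffs ((((c.entries.getD i []).getD j []).map
      (Operand.value A (runSteps A c.steps))))

/-- The shift that a construction builds. -/
def Construction.shiftFun (c : Construction) : Fin c.dim → ℤ :=
  fun i => c.shift.getD i 0

/-- The table of the degrees of the entries of `A` (with `0` for zero entries). -/
def degreeTable (A : Matrix (Fin m) (Fin m) K[X]) : List (List ℕ) :=
  List.ofFn fun i => List.ofFn fun j => (A i j).natDegree

end Run

end PolyMat

end

open PolyMat

/-
Write the entries of `A` in base `X ^ e`. The high digits of an entry go to extra rows attached to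
its row or to extra columns attached to its column, and a unimodular block with the entries `1` and
`-X ^ e` recombines them: its Schur complement is `A`. Hence, if the shift is large enough on the
extra columns, the Popov form of the enlarged matrix is `[P, 0; R, 1]`, where `P` is that of `A`:
the degrees of the diagonal entries of `P` are at most `deg (det A)`, which bounds the shift needed.

A permutation `π` that maximizes `∑ i, 2 ^ deg a_{i,π(i)}` is such that the degree of every entry is
at most that of the entry which `π` selects in the same row, or of the one in the same column. The
number of digits of the latter two thus suffices for the row and for the column. As the selected
degrees have the sum `S ≤ σ(A)`, the choice `e = ⌈S / m⌉` requires at most `m` extra rows and `m`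
extra columns; for `S = 0` there are none, and `e = 1`. Such a `π` depends on the degrees only, and
is found by searching through the lists of natural numbers.
-/

noncomputable section

namespace PolyMat

section LeadingMonomial

variable {K : Type*} [Field K] {n : ℕ} {s : Fin n → ℤ} {v : Fin n → K[X]} {j k : Fin n} {d e : ℕ}

/-- The position of the monomial `X ^ d e_j` in the order of monomial vectors that defines pivots,
the lexicographic order of the pairs `(d + s_j, j)`, encoded as an integer. -/
def monomialRank (s : Fin n → ℤ) (j : Fin n) (d : ℕ) : ℤ := (d + s j) * n + j

theorem monomialRank_le_iff : monomialRank s k e ≤ monomialRank s j d ↔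
    (e : ℤ) + s k < d + s j ∨ ((e : ℤ) + s k = d + s j ∧ k ≤ j) := by
  have hj := j.2
  have hk := k.2
  unfold monomialRank
  rw [Fin.le_def]
  rcases lt_trichotomy ((e : ℤ) + s k) (d + s j) with h | h | h
  · simp only [h, true_or, iff_true]
    nlinarith
  · simp only [h, lt_irrefl, true_and, false_or]
    omega
  · have : ¬ ((e : ℤ) + s k < d + s j ∨ ((e : ℤ) + s k = d + s j ∧ (k : ℕ) ≤ j)) := by omega
    simp only [this, iff_false, not_le]
    nlinarith

theorem eq_of_monomialRank_eq (h : monomialRank s k e = monomialRank s j d) : k = j ∧ e = d := by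
  have h₁ := monomialRank_le_iff.1 h.le
  have h₂ := monomialRank_le_iff.1 h.ge
  have hkj : k = j := by omega
  subst hkj
  exact ⟨rfl, by omega⟩

theorem monomialRank_add (s : Fin n → ℤ) (j : Fin n) (c d : ℕ) :
    monomialRank s j (c + d) = c * n + monomialRank s j d := by
  unfold monomialRank
  push_cast
  ring

theorem monomialRank_le_monomialRank_iff :
    monomialRank s j e ≤ monomialRank s j d ↔ e ≤ d := by
  rw [monomialRank_le_iff]
  omega

theorem bddBelow_range_monomialRank (s : Fin n → ℤ) :
    ∃ b, ∀ j d, b ≤ monomialRank s j d := by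
  obtain ⟨b, hb⟩ := (Set.finite_range fun j => monomialRank s j 0).bddBelow
  exact ⟨b, fun j d => (hb ⟨j, rfl⟩).trans (monomialRank_le_monomialRank_iff.2 d.zero_le)⟩

/-- `X ^ d e_j` is the leading monomial of the vector `v`: its pivot is the entry `j`, and has
degree `d`. -/
def IsLeadingMonomial (s : Fin n → ℤ) (v : Fin n → K[X]) (j : Fin n) (d : ℕ) : Prop :=
  (v j).coeff d ≠ 0 ∧ ∀ k e, (v k).coeff e ≠ 0 → monomialRank s k e ≤ monomialRank s j d

theorem exists_isLeadingMonomial (s : Fin n → ℤ) (hv : v ≠ 0) :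
    ∃ j d, IsLeadingMonomial s v j d := by
  obtain ⟨i, hi⟩ := Function.ne_iff.1 hv
  let monomials := Finset.univ.sigma fun k => (v k).support
  obtain ⟨⟨j, d⟩, hj, hmax⟩ := monomials.exists_max_image (fun x => monomialRank s x.1 x.2)
    ⟨⟨i, (v i).natDegree⟩, by simpa [monomials] using hi⟩
  exact ⟨j, d, by simpa [monomials] using hj,
    fun k e hk => hmax ⟨k, e⟩ (by simpa [monomials] using hk)⟩

theorem isLeadingMonomial_pi_single {p : K[X]} (hp : p ≠ 0) :
    IsLeadingMonomial s (Pi.single j p) j p.natDegree := by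
  refine ⟨by simpa using hp, fun k e hk => ?_⟩
  obtain rfl : k = j := by
    by_contra hkj
    simp [Pi.single_eq_of_ne hkj] at hk
  exact monomialRank_le_monomialRank_iff.2 (le_natDegree_of_ne_zero (by simpa using hk))

namespace IsLeadingMonomial

theorem unique (hj : IsLeadingMonomial s v j d) (hk : IsLeadingMonomial s v k e) :
    k = j ∧ e = d :=
  eq_of_monomialRank_eq (le_antisymm (hj.2 k e hk.1) (hk.2 j d hj.1))

theorem apply_ne_zero (h : IsLeadingMonomial s v j d) : v j ≠ 0 := by
  intro h₀
  exact h.1 (by simp [h₀])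

theorem natDegree_eq (h : IsLeadingMonomial s v j d) : (v j).natDegree = d :=
  le_antisymm
    (monomialRank_le_monomialRank_iff.1
      (h.2 j _ (leadingCoeff_ne_zero.2 h.apply_ne_zero)))
    (le_natDegree_of_ne_zero h.1)

theorem smul {c : K[X]} (hc : c ≠ 0) (h : IsLeadingMonomial s v j d) :
    IsLeadingMonomial s (c • v) j (c.natDegree + d) := by
  constructor
  · rw [Pi.smul_apply, smul_eq_mul, ← h.natDegree_eq, coeff_mul_degree_add_degree]
    exact mul_ne_zero (leadingCoeff_ne_zero.2 hc) (leadingCoeff_ne_zero.2 h.apply_ne_zero)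
  · intro k e hk
    rw [Pi.smul_apply, smul_eq_mul, coeff_mul] at hk
    obtain ⟨⟨a, b⟩, hab, hne⟩ := Finset.exists_ne_zero_of_sum_ne_zero hk
    obtain rfl : a + b = e := Finset.HasAntidiagonal.mem_antidiagonal.1 hab
    have hb := h.2 k b (right_ne_zero_of_mul hne)
    have ha := le_natDegree_of_ne_zero (left_ne_zero_of_mul hne)
    rw [monomialRank_add, monomialRank_add]
    gcongr

theorem exists_smul {a : K} (h : IsLeadingMonomial s v j d) (hde : d ≤ e) (ha : a ≠ 0) :
    ∃ c : K[X], IsLeadingMonomial s (c • v) j e ∧ ((c • v) j).coeff e = a := by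
  have hc : a / (v j).coeff d ≠ 0 := div_ne_zero ha h.1
  obtain ⟨r, rfl⟩ := Nat.exists_eq_add_of_le hde
  refine ⟨monomial r (a / (v j).coeff d), ?_, ?_⟩
  · simpa [natDegree_monomial_eq r hc, add_comm] using
      h.smul ((monomial_eq_zero_iff _ r).not.2 hc)
  · rw [Pi.smul_apply, smul_eq_mul, coeff_monomial_mul, div_mul_cancel₀ _ h.1]

theorem monomialRank_lt_of_coeff_sub_ne_zero {w : Fin n → K[X]} (h : IsLeadingMonomial s w j d)
    (hcancel : (w j).coeff d = (v j).coeff d)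
    (hv : (v k).coeff e ≠ 0 → monomialRank s k e ≤ monomialRank s j d)
    (hne : ((v - w) k).coeff e ≠ 0) : monomialRank s k e < monomialRank s j d := by
  rw [Pi.sub_apply, coeff_sub] at hne
  refine lt_of_le_of_ne ?_ fun heq => ?_
  · by_cases hvk : (v k).coeff e = 0
    · exact h.2 k e fun hwk => hne (by rw [hvk, hwk, sub_zero])
    · exact hv hvk
  · obtain ⟨rfl, rfl⟩ := eq_of_monomialRank_eq heq
    exact hne (by rw [hcancel, sub_self])

end IsLeadingMonomial

/-- No cancellation occurs between leading monomials with distinct positions. -/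
theorem exists_isLeadingMonomial_sum {F : Finset (Fin n)} (hF : F.Nonempty)
    {w : Fin n → Fin n → K[X]} {D : Fin n → ℕ}
    (hw : ∀ i ∈ F, IsLeadingMonomial s (w i) i (D i)) :
    ∃ j ∈ F, IsLeadingMonomial s (∑ i ∈ F, w i) j (D j) := by
  obtain ⟨j, hj, hmax⟩ := F.exists_max_image (fun i => monomialRank s i (D i)) hF
  have hcoeff (k : Fin n) (e : ℕ) :
      ((∑ i ∈ F, w i) k).coeff e = ∑ i ∈ F, (w i k).coeff e := by
    rw [Finset.sum_apply, finsetSum_coeff]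
  refine ⟨j, hj, ?_, fun k e hk => ?_⟩
  · have hother : ∀ i ∈ F, i ≠ j → (w i j).coeff (D j) = 0 := by
      intro i hi hij
      by_contra hne
      exact hij (eq_of_monomialRank_eq (le_antisymm (hmax i hi) ((hw i hi).2 j _ hne))).1
    rw [hcoeff, Finset.sum_eq_single_of_mem j hj hother]
    exact (hw j hj).1
  · rw [hcoeff] at hk
    obtain ⟨i, hi, hne⟩ := Finset.exists_ne_zero_of_sum_ne_zero hk
    exact ((hw i hi).2 k e hne).trans (hmax i hi)

theorem exists_isLeadingMonomial_sum_smul {P : Fin n → Fin n → K[X]} {d : Fin n → ℕ}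
    (hP : ∀ i, IsLeadingMonomial s (P i) i (d i)) {c : Fin n → K[X]} (hc : c ≠ 0) :
    ∃ j e, d j ≤ e ∧ IsLeadingMonomial s (∑ i, c i • P i) j e := by
  classical
  obtain ⟨i, hi⟩ := Function.ne_iff.1 hc
  obtain ⟨j, -, hj⟩ := exists_isLeadingMonomial_sum (F := {i | c i ≠ 0}) ⟨i, by simpa using hi⟩
    (fun i hi => (hP i).smul (by simpa using hi : c i ≠ 0))
  rw [Finset.sum_filter_of_ne fun i _ hne => left_ne_zero_of_smul hne] at hj
  exact ⟨j, _, Nat.le_add_left _ _, hj⟩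

theorem degree_map_add {p : K[X]} (hp : p ≠ 0) (a : ℤ) :
    p.degree.map (fun d : ℕ => (d : ℤ)) + (a : WithBot ℤ) =
      (((p.natDegree : ℤ) + a : ℤ) : WithBot ℤ) := by
  rw [degree_eq_natDegree hp]
  rfl

theorem IsLeadingMonomial.shiftedDegree_eq (h : IsLeadingMonomial s v j d) :
    shiftedDegree s v = ((d + s j : ℤ) : WithBot ℤ) := by
  apply le_antisymm
  · refine Finset.sup_le fun k _ => ?_
    by_cases hk : v k = 0
    · simp [hk]
    · rw [degree_map_add hk]
      have := monomialRank_le_iff.1 (h.2 k _ (leadingCoeff_ne_zero.2 hk))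
      exact_mod_cast (by omega : ((v k).natDegree + s k : ℤ) ≤ d + s j)
  · rw [← h.natDegree_eq, ← degree_map_add h.apply_ne_zero]
    exact Finset.le_sup (f := fun j => (v j).degree.map (fun d : ℕ => (d : ℤ)) + (s j : WithBot ℤ))
      (Finset.mem_univ j)

theorem IsLeadingMonomial.isPivotIndex (h : IsLeadingMonomial s v j d) : IsPivotIndex s v j := by
  refine ⟨fun h₀ => h.apply_ne_zero (congrFun h₀ j), ?_, fun k hk => ?_⟩
  · rw [Set.mem_ofPred_eq, h.shiftedDegree_eq, degree_map_add h.apply_ne_zero, h.natDegree_eq]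
  · rw [Set.mem_ofPred_eq, h.shiftedDegree_eq] at hk
    have hk₀ : v k ≠ 0 := fun h₀ => WithBot.coe_ne_bot (hk.trans (by simp [h₀]))
    rw [degree_map_add hk₀, WithBot.coe_inj] at hk
    have := monomialRank_le_iff.1 (h.2 k _ (leadingCoeff_ne_zero.2 hk₀))
    omega

theorem isPivotIndex_iff :
    IsPivotIndex s v j ↔ IsLeadingMonomial s v j (v j).natDegree := by
  refine ⟨fun h => ?_, IsLeadingMonomial.isPivotIndex⟩
  obtain ⟨k, d, hk⟩ := exists_isLeadingMonomial s h.1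
  obtain rfl : j = k := h.2.unique hk.isPivotIndex.2
  rwa [hk.natDegree_eq]

end LeadingMonomial

section PopovForm

variable {K : Type*} [Field K] {n : ℕ} {s : Fin n → ℤ}

theorem mem_rowSpace_iff {m : ℕ} {P : Matrix (Fin m) (Fin n) K[X]} {v : Fin n → K[X]} :
    v ∈ rowSpace P ↔ ∃ c : Fin m → K[X], ∑ i, c i • P i = v :=
  Submodule.mem_span_range_iff_exists_fun _

theorem row_mem_rowSpace {m : ℕ} (P : Matrix (Fin m) (Fin n) K[X]) (i : Fin m) :
    P i ∈ rowSpace P :=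
  Submodule.subset_span ⟨i, rfl⟩

theorem linearIndependent_of_isLeadingMonomial {P : Fin n → Fin n → K[X]} {d : Fin n → ℕ}
    (hP : ∀ i, IsLeadingMonomial s (P i) i (d i)) : LinearIndependent K[X] P := by
  refine Fintype.linearIndependent_iff.2 fun c hc => ?_
  by_contra! hne
  obtain ⟨j, e, -, hj⟩ := exists_isLeadingMonomial_sum_smul hP (Function.ne_iff.2 hne)
  exact hj.apply_ne_zero (congrFun hc j)

theorem isPopov_iff {P : Matrix (Fin n) (Fin n) K[X]} :
    IsPopov s P ↔ ∀ i, IsLeadingMonomial s (P i) i (P i i).natDegree ∧ (P i i).Monic ∧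
      ∀ i', i' ≠ i → (P i' i).degree < (P i i).degree := by
  constructor
  · rintro ⟨-, piv, hmono, h⟩
    have hrange : Set.range piv = Set.range id := by
      rw [Set.range_id, (Finite.injective_iff_surjective.1 hmono.injective).range_eq]
    obtain rfl : piv = id := (hmono.range_inj strictMono_id).1 hrange
    exact fun i => ⟨isPivotIndex_iff.1 (h i).1, (h i).2⟩
  · exact fun h => ⟨linearIndependent_of_isLeadingMonomial fun i => (h i).1, id, strictMono_id,
      fun i => ⟨(h i).1.isPivotIndex, (h i).2⟩⟩

theorem IsPopov.isReduced {P : Matrix (Fin n) (Fin n) K[X]} (h : IsPopov s P) :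
    IsReduced s P := by
  refine ⟨h.1, ?_⟩
  rw [isPopov_iff] at h
  have hshift (i) : (shiftedDegree s (P.row i)).unbotD 0 = (P i i).natDegree + s i := by
    rw [(h i).1.shiftedDegree_eq (v := P.row i), WithBot.unbotD_coe]
  have hdiag (i) : leadingMatrix s P i i = 1 := by
    simpa [leadingMatrix, hshift] using (h i).2.1.coeff_natDegree
  have hlower : (leadingMatrix s P).IsLowerTriangular := by
    intro i j (hij : i < j)
    simp only [leadingMatrix, Matrix.of_apply, hshift]
    split_ifs with hle
    · by_contra hne
      have := monomialRank_le_iff.1 ((h i).1.2 j _ hne)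
      omega
    · rfl
  refine Matrix.linearIndependent_rows_of_det_ne_zero (A := leadingMatrix s P) ?_
  simp [Matrix.det_of_isLowerTriangular _ hlower, hdiag]

theorem natDegree_le_of_mem_rowSpace {P : Matrix (Fin n) (Fin n) K[X]} {d : Fin n → ℕ}
    (hP : ∀ i, IsLeadingMonomial s (P i) i (d i)) {v : Fin n → K[X]} (hv : v ∈ rowSpace P)
    {j : Fin n} {e : ℕ} (hj : IsLeadingMonomial s v j e) : d j ≤ e := by
  obtain ⟨c, rfl⟩ := mem_rowSpace_iff.1 hv
  have hc : c ≠ 0 := by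
    rintro rfl
    exact hj.apply_ne_zero (by simp)
  obtain ⟨k, e', hle, hk⟩ := exists_isLeadingMonomial_sum_smul hP hc
  obtain ⟨rfl, rfl⟩ := hj.unique hk
  exact hle

theorem eq_zero_of_degree_lt {M : Submodule K[X] (Fin n → K[X])} {d : Fin n → ℕ}
    (hM : ∀ v ∈ M, ∀ j e, IsLeadingMonomial s v j e → d j ≤ e) {v : Fin n → K[X]} (hv : v ∈ M)
    (hlt : ∀ k, (v k).degree < d k) : v = 0 := by
  by_contra h₀
  obtain ⟨j, e, hj⟩ := exists_isLeadingMonomial s h₀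
  exact hj.1 (coeff_eq_zero_of_degree_lt ((hlt j).trans_le (by exact_mod_cast hM v hv j e hj)))

theorem IsPopov.eq {P Q : Matrix (Fin n) (Fin n) K[X]} (hP : IsPopov s P) (hQ : IsPopov s Q)
    (h : rowSpace P = rowSpace Q) : P = Q := by
  rw [isPopov_iff] at hP hQ
  have hPmin {v} (hv : v ∈ rowSpace P) (j e) : IsLeadingMonomial s v j e → (P j j).natDegree ≤ e :=
    natDegree_le_of_mem_rowSpace (fun i => (hP i).1) hv
  have hQmin {v} (hv : v ∈ rowSpace Q) (j e) : IsLeadingMonomial s v j e → (Q j j).natDegree ≤ e :=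
    natDegree_le_of_mem_rowSpace (fun i => (hQ i).1) hv
  have hdeg (j) : (P j j).degree = (Q j j).degree := by
    rw [degree_eq_natDegree (hP j).2.1.ne_zero, degree_eq_natDegree (hQ j).2.1.ne_zero,
      le_antisymm (hPmin (h ▸ row_mem_rowSpace Q j) j _ (hQ j).1)
        (hQmin (h ▸ row_mem_rowSpace P j) j _ (hP j).1)]
  funext j
  rw [← sub_eq_zero]
  refine eq_zero_of_degree_lt (fun v hv => hPmin hv)
    (sub_mem (row_mem_rowSpace P j) (h ▸ row_mem_rowSpace Q j)) fun k => ?_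
  rw [← degree_eq_natDegree (hP k).2.1.ne_zero, Pi.sub_apply]
  by_cases hjk : j = k
  · subst hjk
    exact degree_sub_lt_left (hdeg j) (hP j).2.1.ne_zero
      ((hP j).2.1.leadingCoeff.trans (hQ j).2.1.leadingCoeff.symm)
  · exact (degree_sub_le _ _).trans_lt
      (max_lt ((hP k).2.2 j hjk) (hdeg k ▸ (hQ k).2.2 j hjk))

/-- The induction is on the rank of the largest monomial of `v` that is still to be reduced. -/
theorem exists_sub_degree_lt {N : Submodule K[X] (Fin n → K[X])} {q : Fin n → Fin n → K[X]}
    {d : Fin n → ℕ} (hqN : ∀ j, q j ∈ N) (hq : ∀ j, IsLeadingMonomial s (q j) j (d j))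
    (v : Fin n → K[X]) : ∃ w ∈ N, ∀ k, ((v - w) k).degree < d k := by
  obtain ⟨b, hb⟩ := bddBelow_range_monomialRank s
  have reduce (r : ℕ) : ∀ v : Fin n → K[X],
      (∀ k e, d k ≤ e → (v k).coeff e ≠ 0 → monomialRank s k e < b + r) →
      ∃ w ∈ N, ∀ k, ((v - w) k).degree < d k := by
    induction r with
    | zero =>
      refine fun v hv => ⟨0, zero_mem N, fun k => (degree_lt_iff_coeff_zero _ _).2 fun e he => ?_⟩
      by_contra hne
      rw [sub_zero] at hne
      exact absurd (hb k e) (not_le.2 (by simpa using hv k e he hne))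
    | succ r ih =>
      intro v hv
      simp only [Nat.cast_succ, ← add_assoc, Int.lt_add_one_iff] at hv
      by_cases hr : ∃ k e, d k ≤ e ∧ (v k).coeff e ≠ 0 ∧ monomialRank s k e = b + r
      · obtain ⟨k, e, hke, hne, hrank⟩ := hr
        obtain ⟨c, hc, hcancel⟩ := (hq k).exists_smul hke hne
        obtain ⟨u, huN, hu⟩ := ih (v - c • q k) fun l f hlf hnz =>
          hrank ▸ hc.monomialRank_lt_of_coeff_sub_ne_zero hcancel (hrank ▸ hv l f hlf) hnz
        exact ⟨_, add_mem (N.smul_mem c (hqN k)) huN, fun l => by simpa only [sub_sub] using hu l⟩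
      · exact ih v fun k e hke hne =>
          lt_of_le_of_ne (hv k e hke hne) fun heq => hr ⟨k, e, hke, hne, heq⟩
  by_cases hv : v = 0
  · exact reduce 0 v (by simp [hv])
  · obtain ⟨j, e, hj⟩ := exists_isLeadingMonomial s hv
    refine reduce (monomialRank s j e + 1 - b).toNat v fun k f _ hne => ?_
    have := hj.2 k f hne
    omega

theorem det_smul_mem_rowSpace (A : Matrix (Fin n) (Fin n) K[X]) (v : Fin n → K[X]) :
    A.det • v ∈ rowSpace A := by
  refine mem_rowSpace_iff.2 ⟨Matrix.vecMul v A.adjugate, ?_⟩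
  calc ∑ i, Matrix.vecMul v A.adjugate i • A i
      = Matrix.vecMul (Matrix.vecMul v A.adjugate) A := (Matrix.vecMul_eq_sum _ _).symm
    _ = A.det • v := by
      rw [Matrix.vecMul_vecMul, Matrix.adjugate_mul, Matrix.vecMul_smul, Matrix.vecMul_one]

theorem isLeadingMonomial_det_smul {A : Matrix (Fin n) (Fin n) K[X]} (hA : A.det ≠ 0) (j : Fin n) :
    IsLeadingMonomial s (A.det • (Pi.single j 1 : Fin n → K[X])) j A.det.natDegree := by
  rw [← Pi.single_smul', smul_eq_mul, mul_one]
  exact isLeadingMonomial_pi_single hA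

theorem monic_and_natDegree_of_degree_X_pow_sub_lt {p : K[X]} {d : ℕ}
    (h : (X ^ d - p).degree < (d : WithBot ℕ)) : p.Monic ∧ p.natDegree = d := by
  rw [← sub_sub_cancel (X ^ d) p]
  refine ⟨monic_X_pow_sub h, natDegree_eq_of_degree_eq_some ?_⟩
  rw [degree_sub_eq_left_of_degree_lt (by rwa [degree_X_pow]), degree_X_pow]

/-- Row `j` is `X ^ d_j e_j` minus its remainder modulo the module, where `d_j` is the least
degree of a pivot at `j`. -/
theorem exists_isPopov_of_submodule (s : Fin n → ℤ) {M : Submodule K[X] (Fin n → K[X])}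
    (hM : ∀ j, ∃ v ∈ M, ∃ d, IsLeadingMonomial s v j d) :
    ∃ P : Matrix (Fin n) (Fin n) K[X], IsPopov s P ∧ rowSpace P = M := by
  classical
  have hM' (j) : ∃ d, ∃ v ∈ M, IsLeadingMonomial s v j d := by
    obtain ⟨v, hv, d, hj⟩ := hM j
    exact ⟨d, v, hv, hj⟩
  let d (j : Fin n) : ℕ := Nat.find (hM' j)
  have hmin (v) (hv : v ∈ M) (j e) (hj : IsLeadingMonomial s v j e) : d j ≤ e :=
    Nat.find_min' (hM' j) ⟨v, hv, hj⟩
  have hbasis (j) : ∃ v ∈ M, IsLeadingMonomial s v j (d j) := Nat.find_spec (hM' j)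
  choose q hqM hq using hbasis
  choose P hPM hP using fun j => exists_sub_degree_lt hqM hq (Pi.single j (X ^ d j))
  have hdiag (j) : (P j j).Monic ∧ (P j j).natDegree = d j :=
    monic_and_natDegree_of_degree_X_pow_sub_lt (by simpa using hP j j)
  have hoff (j k) (hjk : j ≠ k) : (P j k).degree < d k := by
    simpa [Pi.single_eq_of_ne' hjk] using hP j k
  have hlead (j) : IsLeadingMonomial s (P j) j (d j) := by
    obtain ⟨k, e, hk⟩ := exists_isLeadingMonomial s
      (Function.ne_iff.2 ⟨j, (hdiag j).1.ne_zero⟩ : P j ≠ 0)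
    obtain rfl : k = j := by
      by_contra hkj
      have := (degree_lt_iff_coeff_zero _ _).1 (hoff j k (Ne.symm hkj)) e (hmin _ (hPM j) k e hk)
      exact hk.1 this
    rwa [← (hdiag k).2, hk.natDegree_eq]
  refine ⟨Matrix.of P, isPopov_iff.2 fun i => ⟨?_, (hdiag i).1, fun j hji => ?_⟩, ?_⟩
  · exact (hdiag i).2.symm ▸ hlead i
  · rw [Matrix.of_apply, Matrix.of_apply, degree_eq_natDegree (hdiag i).1.ne_zero, (hdiag i).2]
    exact hoff j i hji
  · refine le_antisymm (Submodule.span_le.2 (Set.range_subset_iff.2 hPM)) fun v hv => ?_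
    obtain ⟨w, hw, hlt⟩ := exists_sub_degree_lt (row_mem_rowSpace (Matrix.of P)) hlead v
    have hwM : w ∈ M := Submodule.span_le.2 (Set.range_subset_iff.2 hPM) hw
    rwa [← sub_eq_zero.1 (eq_zero_of_degree_lt hmin (sub_mem hv hwM) hlt)] at hw

theorem exists_isPopovFormOf (s : Fin n → ℤ) {A : Matrix (Fin n) (Fin n) K[X]} (hA : A.det ≠ 0) :
    ∃ P, IsPopovFormOf s A P := by
  obtain ⟨P, hP, hspan⟩ := exists_isPopov_of_submodule s fun j =>
    ⟨_, det_smul_mem_rowSpace A _, _, isLeadingMonomial_det_smul hA j⟩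
  exact ⟨P, hspan, hP.isReduced, hP⟩

namespace IsPopovFormOf

variable {A P : Matrix (Fin n) (Fin n) K[X]}

theorem iff_eq (hP : IsPopovFormOf s A P) (Q : Matrix (Fin n) (Fin n) K[X]) :
    IsPopovFormOf s A Q ↔ Q = P :=
  ⟨fun hQ => hQ.2.2.eq hP.2.2 (hQ.1.trans hP.1.symm), fun hQ => hQ ▸ hP⟩

theorem natDegree_diag_le (hP : IsPopovFormOf s A P) (hA : A.det ≠ 0) (j : Fin n) :
    (P j j).natDegree ≤ A.det.natDegree :=
  natDegree_le_of_mem_rowSpace (fun i => (isPopov_iff.1 hP.2.2 i).1)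
    (hP.1 ▸ det_smul_mem_rowSpace A _) (isLeadingMonomial_det_smul hA j)

end IsPopovFormOf

theorem rowSpace_mul_of_isUnit {U : Matrix (Fin n) (Fin n) K[X]} (hU : IsUnit U)
    (A : Matrix (Fin n) (Fin n) K[X]) : rowSpace (U * A) = rowSpace A := by
  have hle (U A : Matrix (Fin n) (Fin n) K[X]) : rowSpace (U * A) ≤ rowSpace A := by
    refine Submodule.span_le.2 (Set.range_subset_iff.2 fun i => ?_)
    exact mem_rowSpace_iff.2 ⟨U i, (Matrix.vecMul_eq_sum _ _).symm⟩
  refine le_antisymm (hle U A) ?_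
  obtain ⟨V, hV⟩ := hU.exists_left_inv
  simpa only [← mul_assoc, hV, one_mul] using hle V (U * A)

theorem exists_isUnit_mul_eq_of_rowSpace_eq {A P : Matrix (Fin n) (Fin n) K[X]} (hA : A.det ≠ 0)
    (h : rowSpace P = rowSpace A) : ∃ U, IsUnit U ∧ P = U * A := by
  have hle {P A : Matrix (Fin n) (Fin n) K[X]} (h : rowSpace P ≤ rowSpace A) :
      ∃ U : Matrix (Fin n) (Fin n) K[X], P = U * A := by
    choose U hU using fun i => mem_rowSpace_iff.1 (h (row_mem_rowSpace P i))
    exact ⟨Matrix.of U, funext fun i => (hU i).symm.trans (Matrix.vecMul_eq_sum _ _).symm⟩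
  obtain ⟨U, rfl⟩ := hle h.le
  obtain ⟨V, hV⟩ := hle h.ge
  refine ⟨U, U.isUnit_iff_isUnit_det.2 (IsUnit.of_mul_eq_one V.det ?_), rfl⟩
  refine mul_right_cancel₀ hA ?_
  calc U.det * V.det * A.det = (V * (U * A)).det := by simp only [Matrix.det_mul]; ring
    _ = 1 * A.det := by rw [← hV, one_mul]

end PopovForm

section SchurComplement

variable {K : Type*} [Field K] {m N : ℕ} {κ : Type*} [DecidableEq κ] {s : Fin m → ℤ}
  {u : Fin N → ℤ} {hmN : m ≤ N} {f : Fin N ≃ Fin m ⊕ κ}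

theorem isLeadingMonomial_fromBlocks_inl {P : Matrix (Fin m) (Fin m) K[X]} {i : Fin m} {d : ℕ}
    (hP : IsLeadingMonomial s (P i) i d) (R : Matrix κ (Fin m) K[X])
    (hf : ∀ i, f (Fin.castLE hmN i) = .inl i) (hu : ∀ i, u (Fin.castLE hmN i) = s i) :
    IsLeadingMonomial u ((Matrix.fromBlocks P 0 R 1).submatrix f f (Fin.castLE hmN i))
      (Fin.castLE hmN i) d := by
  refine ⟨by simpa [hf] using hP.1, f.symm.surjective.forall.2 ?_⟩
  rintro (k | x) e hne
  · have := monomialRank_le_iff.1 (hP.2 k e (by simpa [hf] using hne))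
    rw [f.symm_apply_eq.2 (hf k).symm, monomialRank_le_iff, hu, hu]
    simpa using this
  · simp [hf] at hne

theorem isLeadingMonomial_fromBlocks_inr {P : Matrix (Fin m) (Fin m) K[X]}
    {R : Matrix κ (Fin m) K[X]} {x : κ} (hR : ∀ k, (R x k).degree < (P k k).degree)
    (hf : ∀ i, f (Fin.castLE hmN i) = .inl i) (hu : ∀ i, u (Fin.castLE hmN i) = s i)
    (hlarge : ∀ k, (P k k).natDegree + s k ≤ u (f.symm (.inr x))) :
    IsLeadingMonomial u ((Matrix.fromBlocks P 0 R 1).submatrix f f (f.symm (.inr x)))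
      (f.symm (.inr x)) 0 := by
  refine ⟨by simp, f.symm.surjective.forall.2 ?_⟩
  rintro (k | y) e hne
  · have hlt : e < (P k k).natDegree := by
      by_contra! hle
      exact hne (by simpa using
        coeff_eq_zero_of_degree_lt ((hR k).trans_le (degree_le_of_natDegree_le hle)))
    rw [f.symm_apply_eq.2 (hf k).symm, monomialRank_le_iff, hu]
    have := hlarge k
    omega
  · obtain rfl | hxy := eq_or_ne x y
    · obtain rfl : e = 0 := by simpa [coeff_one] using hne
      exact le_rfl
    · simp [hxy] at hne

theorem IsPopov.fromBlocks {P : Matrix (Fin m) (Fin m) K[X]} (hP : IsPopov s P)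
    {R : Matrix κ (Fin m) K[X]} (hR : ∀ x k, (R x k).degree < (P k k).degree)
    (hf : ∀ i, f (Fin.castLE hmN i) = .inl i) (hu : ∀ i, u (Fin.castLE hmN i) = s i)
    (hlarge : ∀ k x, (P k k).natDegree + s k ≤ u (f.symm (.inr x))) :
    IsPopov u ((Matrix.fromBlocks P 0 R 1).submatrix f f) := by
  rw [isPopov_iff] at hP ⊢
  refine f.symm.surjective.forall.2 (Sum.forall.2 ⟨fun i => ?_, fun x => ?_⟩)
  · rw [f.symm_apply_eq.2 (hf i).symm]
    refine ⟨?_, by simpa [hf] using (hP i).2.1, f.symm.surjective.forall.2 ?_⟩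
    · simpa [hf] using isLeadingMonomial_fromBlocks_inl (hP i).1 R hf hu
    · rintro (k | x) hne
      · simpa [hf] using (hP i).2.2 k fun hki => hne (by rw [hki, f.symm_apply_eq, hf])
      · simpa [hf] using hR x i
  · refine ⟨?_, by simp, f.symm.surjective.forall.2 ?_⟩
    · simpa using isLeadingMonomial_fromBlocks_inr (hR x) hf hu (hlarge · x)
    · rintro (k | y) hne
      · simp
      · have hyx : y ≠ x := fun h => hne (by rw [h])
        simp [hyx]

variable [Fintype κ]

theorem rowSpace_submatrix_mul_of_isUnit {U : Matrix (Fin m ⊕ κ) (Fin m ⊕ κ) K[X]} (hU : IsUnit U)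
    (M : Matrix (Fin m ⊕ κ) (Fin m ⊕ κ) K[X]) :
    rowSpace ((U * M).submatrix f f) = rowSpace (M.submatrix f f) := by
  rw [← Matrix.submatrix_mul_equiv U M f f f]
  exact rowSpace_mul_of_isUnit ((Matrix.isUnit_submatrix_equiv (A := U) f f).2 hU) _

theorem fromBlocks_eq_mul_of_isUnit {ι R : Type*} [CommRing R] [DecidableEq ι] [Fintype ι]
    {D : Matrix κ κ R} (hD : IsUnit D) (B : Matrix ι ι R) (C : Matrix ι κ R) (H : Matrix κ ι R) :
    Matrix.fromBlocks B C H D =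
      Matrix.fromBlocks 1 C 0 D * Matrix.fromBlocks (B - C * D⁻¹ * H) 0 (D⁻¹ * H) 1 := by
  simp [Matrix.fromBlocks_multiply, Matrix.mul_assoc,
    Matrix.mul_nonsing_inv_cancel_left _ _ (D.isUnit_iff_isUnit_det.1 hD)]

/-- The bottom rows `D⁻¹ * H` of the block factorization are reduced modulo the Popov form of the
Schur complement. -/
theorem exists_isPopovFormOf_fromBlocks {B P : Matrix (Fin m) (Fin m) K[X]}
    {C : Matrix (Fin m) κ K[X]} {H : Matrix κ (Fin m) K[X]} {D : Matrix κ κ K[X]} (hD : IsUnit D)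
    (hS : (B - C * D⁻¹ * H).det ≠ 0) (hP : IsPopovFormOf s (B - C * D⁻¹ * H) P)
    (hf : ∀ i, f (Fin.castLE hmN i) = .inl i) (hu : ∀ i, u (Fin.castLE hmN i) = s i)
    (hlarge : ∀ k x, (P k k).natDegree + s k ≤ u (f.symm (.inr x))) :
    ∃ R : Matrix κ (Fin m) K[X], IsPopovFormOf u ((Matrix.fromBlocks B C H D).submatrix f f)
      ((Matrix.fromBlocks P 0 R 1).submatrix f f) := by
  have hpopov := isPopov_iff.1 hP.2.2
  obtain ⟨U, hU, hUS⟩ := exists_isUnit_mul_eq_of_rowSpace_eq hS hP.1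
  choose w hwP hw using fun x =>
    exists_sub_degree_lt (row_mem_rowSpace P) (fun i => (hpopov i).1) ((D⁻¹ * H) x)
  choose c hc using fun x => mem_rowSpace_iff.1 (hwP x)
  have hcP : Matrix.of c * P = Matrix.of w :=
    funext fun x => (Matrix.vecMul_eq_sum _ _).trans (hc x)
  have hQ := hP.2.2.fromBlocks (R := D⁻¹ * H - Matrix.of c * P) (fun x k => by
    rw [hcP, degree_eq_natDegree (hpopov k).2.1.ne_zero]
    exact hw x k) hf hu hlarge
  have hreduce : Matrix.fromBlocks P 0 (D⁻¹ * H - Matrix.of c * P) (1 : Matrix κ κ K[X]) =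
      Matrix.fromBlocks U 0 (-(Matrix.of c * U)) 1 *
        Matrix.fromBlocks (B - C * D⁻¹ * H) 0 (D⁻¹ * H) 1 := by
    rw [Matrix.fromBlocks_multiply]
    simp [hUS, Matrix.mul_assoc, neg_add_eq_sub]
  refine ⟨_, ?_, hQ.isReduced, hQ⟩
  rw [hreduce, fromBlocks_eq_mul_of_isUnit hD, rowSpace_submatrix_mul_of_isUnit,
    rowSpace_submatrix_mul_of_isUnit]
  · exact Matrix.isUnit_fromBlocks_zero₂₁.2 ⟨isUnit_one, hD⟩
  · exact Matrix.isUnit_fromBlocks_zero₁₂.2 ⟨hU, isUnit_one⟩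

theorem det_fromBlocks_ne_zero {ι R : Type*} [CommRing R] [IsDomain R] [DecidableEq ι] [Fintype ι]
    {B : Matrix ι ι R} {C : Matrix ι κ R} {H : Matrix κ ι R} {D : Matrix κ κ R} (hD : IsUnit D)
    (hS : (B - C * D⁻¹ * H).det ≠ 0) : (Matrix.fromBlocks B C H D).det ≠ 0 := by
  rw [fromBlocks_eq_mul_of_isUnit hD, Matrix.det_mul, Matrix.det_fromBlocks_zero₂₁,
    Matrix.det_fromBlocks_zero₁₂, Matrix.det_one, Matrix.det_one, one_mul, mul_one]
  exact mul_ne_zero (D.isUnit_iff_isUnit_det.1 hD).ne_zero hS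

end SchurComplement

section Digits

variable {R : Type*} [CommRing R]

/-- The digit of index `l` of a polynomial in base `X ^ e`. -/
def digit (e l : ℕ) (a : R[X]) : R[X] :=
  ∑ k ∈ Finset.range e, C (a.coeff (l * e + k)) * X ^ k

/-- The quotient of `a` by `X ^ n`, by iteration of the division `divX` by `X`. -/
def divXPow (n : ℕ) (a : R[X]) : R[X] := divX^[n] a

theorem coeff_divXPow (n : ℕ) (a : R[X]) (k : ℕ) : (divXPow n a).coeff k = a.coeff (k + n) := by
  unfold divXPow
  induction n generalizing a with
  | zero => rfl
  | succ n ih => rw [Function.iterate_succ_apply, ih, coeff_divX, add_assoc]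

theorem divXPow_eq_zero {n : ℕ} {a : R[X]} (h : a.natDegree < n) : divXPow n a = 0 := by
  ext k
  rw [coeff_divXPow, coeff_zero, coeff_eq_zero_of_natDegree_lt (by omega)]

theorem coeff_digit (e l : ℕ) (a : R[X]) (n : ℕ) :
    (digit e l a).coeff n = if n < e then a.coeff (l * e + n) else 0 := by
  simp [digit, finsetSum_coeff, coeff_X_pow]

theorem digit_zero_right (e l : ℕ) : digit e l (0 : R[X]) = 0 := by
  simp [digit]

theorem digit_add (e l : ℕ) (a b : R[X]) : digit e l (a + b) = digit e l a + digit e l b := by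
  simp [digit, add_mul, Finset.sum_add_distrib]

theorem digit_add_X_pow_mul_divXPow (e l : ℕ) (a : R[X]) :
    digit e l a + X ^ e * divXPow ((l + 1) * e) a = divXPow (l * e) a := by
  ext n
  rw [coeff_add, coeff_digit, coeff_X_pow_mul', coeff_divXPow, coeff_divXPow, add_one_mul]
  split_ifs with hlt hle hle
  · omega
  · rw [add_zero, add_comm]
  · rw [zero_add]
    congr 1
    omega
  · omega

theorem natDegree_digit_le (e l : ℕ) (a : R[X]) : (digit e l a).natDegree ≤ e - 1 :=
  natDegree_sum_le_of_forall_le _ _ fun _ hk =>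
    (natDegree_C_mul_X_pow_le _ _).trans (Nat.le_sub_one_of_lt (Finset.mem_range.1 hk))

end Digits

section Linearization

open scoped Matrix

variable {R : Type*} [CommRing R] {ι ι' : Type*} [DecidableEq ι] {e : ℕ} {α : ι → ℕ}

/-- The row vector, indexed by the digits of index `1, …, α i` of the rows `i` of a matrix, with the
entry `-X ^ e` at `(i, k)` and no other nonzero entry; it is zero if `k` is out of range. -/
def negXPowAt (R : Type*) [CommRing R] (e : ℕ) (α : ι → ℕ) (i : ι) (k : ℕ) :
    (Σ i, Fin (α i)) → R[X] :=
  fun y => if y.1 = i ∧ (y.2 : ℕ) = k then -X ^ e else 0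

/-- The matrix of the relations between the consecutive quotients of the rows by the powers of
`X ^ e`. -/
def chain (R : Type*) [CommRing R] (e : ℕ) (α : ι → ℕ) :
    Matrix (Σ i, Fin (α i)) (Σ i, Fin (α i)) R[X] :=
  1 + Matrix.of fun x => negXPowAt R e α x.1 (x.2 + 1)

/-- The matrix that attaches the rows to the first of their quotients by the powers of `X ^ e`. -/
def link (R : Type*) [CommRing R] (e : ℕ) (α : ι → ℕ) : Matrix ι (Σ i, Fin (α i)) R[X] :=
  Matrix.of fun i => negXPowAt R e α i 0

/-- The digits in base `X ^ e` of index `1, …, α i` of the entries of the rows `i` of `M`. -/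
def highDigits (e : ℕ) (α : ι → ℕ) (M : Matrix ι ι' R[X]) : Matrix (Σ i, Fin (α i)) ι' R[X] :=
  Matrix.of fun x j => digit e (x.2 + 1) (M x.1 j)

/-- The quotients of the entries of the rows `i` of `M` by `X ^ e, …, X ^ (α i * e)`. -/
def quotients (e : ℕ) (α : ι → ℕ) (M : Matrix ι ι' R[X]) : Matrix (Σ i, Fin (α i)) ι' R[X] :=
  Matrix.of fun x j => divXPow ((x.2 + 1) * e) (M x.1 j)

/-- The matrix of the relations between the consecutive quotients of the rows of `M` and of the
columns of `N`. -/
def chains (R : Type*) [CommRing R] (e : ℕ) (α β : ι → ℕ) :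
    Matrix ((Σ i, Fin (α i)) ⊕ (Σ j, Fin (β j))) ((Σ i, Fin (α i)) ⊕ (Σ j, Fin (β j))) R[X] :=
  Matrix.fromBlocks (chain R e α) 0 0 (chain R e β)ᵀ

/-- The partial linearization of `M + N`, in which the entries of the row `i` of `M` are expanded
into `α i + 1` digits, and those of the column `j` of `N` into `β j + 1` digits. -/
def linearization (e : ℕ) (α β : ι → ℕ) (M N : Matrix ι ι R[X]) :
    Matrix (ι ⊕ ((Σ i, Fin (α i)) ⊕ (Σ j, Fin (β j))))
      (ι ⊕ ((Σ i, Fin (α i)) ⊕ (Σ j, Fin (β j)))) R[X] :=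
  Matrix.fromBlocks ((M + N).map (digit e 0))
    (Matrix.fromCols (link R e α) (highDigits e β Nᵀ)ᵀ)
    (Matrix.fromRows (highDigits e α M) (link R e β)ᵀ)
    (chains R e α β)

variable {β : ι → ℕ} {M N : Matrix ι ι R[X]}

theorem natDegree_negXPowAt_le (e : ℕ) (α : ι → ℕ) (i : ι) (k : ℕ) (x : Σ i, Fin (α i)) :
    (negXPowAt R e α i k x).natDegree ≤ e := by
  unfold negXPowAt
  split_ifs
  · exact (natDegree_neg _).trans_le (natDegree_X_pow_le e)
  · simp

theorem natDegree_chain_le (e : ℕ) (α : ι → ℕ) (x y : Σ i, Fin (α i)) :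
    (chain R e α x y).natDegree ≤ e := by
  rw [chain, Matrix.add_apply, Matrix.one_apply]
  refine natDegree_add_le_of_degree_le ?_ (natDegree_negXPowAt_le e α x.1 (x.2 + 1) y)
  split_ifs <;> simp

theorem natDegree_linearization_le {δ : ℕ} (hδ : e - 1 ≤ δ)
    (hextra : Nonempty ((Σ i, Fin (α i)) ⊕ (Σ j, Fin (β j))) → e ≤ δ)
    (x y : ι ⊕ ((Σ i, Fin (α i)) ⊕ (Σ j, Fin (β j)))) :
    (linearization e α β M N x y).natDegree ≤ δ := by
  have hdigit (l : ℕ) (a : R[X]) : (digit e l a).natDegree ≤ δ :=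
    (natDegree_digit_le e l a).trans hδ
  rcases x with i | x
  · rcases y with j | y
    · exact hdigit 0 _
    · have he := hextra ⟨y⟩
      rcases y with y | y
      · exact (natDegree_negXPowAt_le e α i 0 y).trans he
      · exact hdigit (y.2 + 1) _
  · have he := hextra ⟨x⟩
    rcases x with x | x <;> rcases y with j | y | y
    · exact hdigit (x.2 + 1) _
    · exact (natDegree_chain_le e α x y).trans he
    · simp [linearization, chains]
    · exact (natDegree_negXPowAt_le e β j 0 x).trans he
    · simp [linearization, chains]
    · exact (natDegree_chain_le e β y x).trans he

variable [Fintype ι]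

theorem isUnit_chain : IsUnit (chain R e α) := by
  have htriangular : (chain R e α).BlockTriangular fun x => (x.2 : ℕ) := by
    intro x y hyx
    have hne : x ≠ y := fun h => hyx.ne (by rw [h])
    have hlt : (y.2 : ℕ) < x.2 := hyx
    simp [chain, negXPowAt, hne, show (y.2 : ℕ) ≠ x.2 + 1 by omega]
  have hblock (k : ℕ) : (chain R e α).toSquareBlock (fun x => (x.2 : ℕ)) k = 1 := by
    ext1 ⟨x, hx⟩ ⟨y, hy⟩
    simp [chain, negXPowAt, Matrix.toSquareBlock_def, Matrix.one_apply,
      show (y.2 : ℕ) ≠ x.2 + 1 by omega]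
  rw [Matrix.isUnit_iff_isUnit_det, htriangular.det]
  simp [hblock]

theorem sum_negXPowAt_mul_quotients {M : Matrix ι ι' R[X]}
    (hM : ∀ i j, (M i j).natDegree < (α i + 1) * e) (i : ι) (k : ℕ) (j : ι') :
    ∑ y, negXPowAt R e α i k y * quotients e α M y j =
      -X ^ e * divXPow ((k + 1) * e) (M i j) := by
  by_cases hk : k < α i
  · rw [Finset.sum_eq_single_of_mem ⟨i, k, hk⟩ (Finset.mem_univ _)]
    · simp [negXPowAt, quotients]
    · rintro ⟨i', k'⟩ - hne
      have : ¬(i' = i ∧ (k' : ℕ) = k) := by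
        rintro ⟨rfl, rfl⟩
        exact hne rfl
      simp [negXPowAt, this]
  · have hvanish : divXPow ((k + 1) * e) (M i j) = 0 :=
      divXPow_eq_zero ((hM i j).trans_le (Nat.mul_le_mul_right e (by omega)))
    rw [hvanish, mul_zero]
    refine Finset.sum_eq_zero fun y _ => ?_
    have : ¬(y.1 = i ∧ (y.2 : ℕ) = k) := by
      rintro ⟨rfl, rfl⟩
      exact hk y.2.2
    simp [negXPowAt, this]

theorem chain_mul_quotients {M : Matrix ι ι' R[X]}
    (hM : ∀ i j, (M i j).natDegree < (α i + 1) * e) :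
    chain R e α * quotients e α M = highDigits e α M := by
  ext1 x j
  rw [chain, Matrix.add_mul, Matrix.one_mul, Matrix.add_apply, Matrix.mul_apply]
  simp only [Matrix.of_apply, sum_negXPowAt_mul_quotients hM x.1 (x.2 + 1) j]
  rw [quotients, highDigits, Matrix.of_apply, Matrix.of_apply,
    ← digit_add_X_pow_mul_divXPow e (x.2 + 1), neg_mul, add_neg_cancel_right]

theorem map_digit_zero_sub_link_mul {M : Matrix ι ι' R[X]}
    (hM : ∀ i j, (M i j).natDegree < (α i + 1) * e) :
    M.map (digit e 0) - link R e α * (chain R e α)⁻¹ * highDigits e α M = M := by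
  rw [← chain_mul_quotients hM, Matrix.mul_assoc, Matrix.nonsing_inv_mul_cancel_left _ _
    ((chain R e α).isUnit_iff_isUnit_det.1 isUnit_chain)]
  ext1 i j
  have hdigit := digit_add_X_pow_mul_divXPow e 0 (M i j)
  have hsum := sum_negXPowAt_mul_quotients hM i 0 j
  rw [Matrix.sub_apply, Matrix.mul_apply]
  simp only [link, Matrix.of_apply, hsum, Matrix.map_apply]
  rw [neg_mul, sub_neg_eq_add, hdigit, zero_mul]
  rfl

theorem isUnit_chains : IsUnit (chains R e α β) :=
  Matrix.isUnit_fromBlocks_zero₂₁.2 ⟨isUnit_chain, (chain R e β).isUnit_transpose.2 isUnit_chain⟩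

theorem map_digit_zero_sub_mul_chains (hM : ∀ i j, (M i j).natDegree < (α i + 1) * e)
    (hN : ∀ i j, (N i j).natDegree < (β j + 1) * e) :
    (M + N).map (digit e 0) - Matrix.fromCols (link R e α) (highDigits e β Nᵀ)ᵀ *
      (chains R e α β)⁻¹ * Matrix.fromRows (highDigits e α M) (link R e β)ᵀ = M + N := by
  have hrows := map_digit_zero_sub_link_mul hM
  have hcols := congrArg Matrix.transpose
    (map_digit_zero_sub_link_mul (M := Nᵀ) (α := β) fun i j => hN j i)
  rw [Matrix.transpose_sub, Matrix.transpose_mul, Matrix.transpose_mul,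
    Matrix.transpose_nonsing_inv, ← Matrix.mul_assoc, Matrix.transpose_transpose] at hcols
  have hmap : (M + N).map (digit e 0) = M.map (digit e 0) + (Nᵀ.map (digit e 0))ᵀ := by
    ext1 i j
    exact digit_add e 0 (M i j) (N i j)
  have hinv : (chains R e α β)⁻¹ =
      Matrix.fromBlocks (chain R e α)⁻¹ 0 0 ((chain R e β)ᵀ)⁻¹ := by
    rw [chains, Matrix.inv_fromBlocks_zero₂₁_of_isUnit_iff _ _ _ (iff_of_true isUnit_chain
      ((chain R e β).isUnit_transpose.2 isUnit_chain))]
    simp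
  rw [hinv, Matrix.fromCols_mul_fromBlocks, Matrix.fromCols_mul_fromRows, hmap]
  simp only [Matrix.mul_zero, add_zero, zero_add]
  rw [add_sub_add_comm, hrows, hcols]

theorem det_linearization_ne_zero [IsDomain R]
    (hM : ∀ i j, (M i j).natDegree < (α i + 1) * e)
    (hN : ∀ i j, (N i j).natDegree < (β j + 1) * e) (hdet : (M + N).det ≠ 0) :
    (linearization e α β M N).det ≠ 0 :=
  det_fromBlocks_ne_zero isUnit_chains (by rwa [map_digit_zero_sub_mul_chains hM hN])

theorem exists_isPopovFormOf_linearization {K : Type*} [Field K] {m n : ℕ} {s : Fin m → ℤ}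
    {u : Fin n → ℤ} {α β : Fin m → ℕ} {M N P : Matrix (Fin m) (Fin m) K[X]} {hmn : m ≤ n}
    {f : Fin n ≃ Fin m ⊕ ((Σ i, Fin (α i)) ⊕ (Σ j, Fin (β j)))}
    (hM : ∀ i j, (M i j).natDegree < (α i + 1) * e)
    (hN : ∀ i j, (N i j).natDegree < (β j + 1) * e) (hdet : (M + N).det ≠ 0)
    (hP : IsPopovFormOf s (M + N) P) (hf : ∀ i, f (Fin.castLE hmn i) = .inl i)
    (hu : ∀ i, u (Fin.castLE hmn i) = s i)
    (hlarge : ∀ k x, (P k k).natDegree + s k ≤ u (f.symm (.inr x))) :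
    ∃ Q, IsPopovFormOf u ((linearization e α β M N).submatrix f f) Q ∧
      Q.submatrix (Fin.castLE hmn) (Fin.castLE hmn) = P := by
  have hS := map_digit_zero_sub_mul_chains hM hN
  obtain ⟨Q, hQ⟩ := exists_isPopovFormOf_fromBlocks isUnit_chains (by rwa [hS])
    (by rwa [hS]) hf hu hlarge
  exact ⟨_, hQ, by ext1 i j; simp [hf]⟩

end Linearization

section Labels

variable {m : ℕ} {α β : ℕ → ℕ}

/-- The indices of the partial linearization of an `m × m` matrix. -/
abbrev Index (m : ℕ) (α β : ℕ → ℕ) : Type :=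
  Fin m ⊕ ((Σ i : Fin m, Fin (α i)) ⊕ (Σ j : Fin m, Fin (β j)))

/-- The codes of the elements of the types `Index m α β`. -/
abbrev Label : Type := ℕ ⊕ ((ℕ × ℕ) ⊕ (ℕ × ℕ))

/-- The code of a pair. -/
def pairLabel (x : Σ i : Fin m, Fin (α i)) : ℕ × ℕ := (x.1, x.2)

theorem pairLabel_injective :
    Function.Injective (pairLabel : (Σ i : Fin m, Fin (α i)) → ℕ × ℕ) := by
  rintro ⟨i, k⟩ ⟨j, l⟩ h
  obtain rfl : i = j := Fin.ext (congrArg Prod.fst h)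
  obtain rfl : k = l := Fin.ext (congrArg Prod.snd h)
  rfl

/-- The code of an index. -/
def Index.label : Index m α β → Label :=
  Sum.map Fin.val (Sum.map pairLabel pairLabel)

/-- The indices in order: those of the given matrix come first. -/
def indices (m : ℕ) (α β : ℕ → ℕ) : List (Index m α β) :=
  (List.finRange m).map .inl ++
    (((List.finRange m).sigma fun i => List.finRange (α i)).map (.inr ∘ .inl) ++
      ((List.finRange m).sigma fun j => List.finRange (β j)).map (.inr ∘ .inr))

/-- The pairs `(i, k)` with `i < m` and `k < α i`. -/
def pairs (m : ℕ) (α : ℕ → ℕ) : List (ℕ × ℕ) :=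
  (List.range m).flatMap fun i => (List.range (α i)).map fun k => (i, k)

/-- The codes of the indices, in order. -/
def labels (m : ℕ) (α β : ℕ → ℕ) : List Label :=
  (List.range m).map .inl ++
    ((pairs m α).map (.inr ∘ .inl) ++ (pairs m β).map (.inr ∘ .inr))

theorem map_finRange_sigma (m : ℕ) (α : ℕ → ℕ) :
    ((List.finRange m).sigma fun i => List.finRange (α i)).map pairLabel = pairs m α := by
  rw [pairs, List.sigma, List.map_flatMap, ← List.map_coe_finRange_eq_range, List.flatMap_map]
  congr 1
  funext i
  rw [← List.map_coe_finRange_eq_range, List.map_map, List.map_map]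
  rfl

theorem map_label_indices : (indices m α β).map Index.label = labels m α β := by
  rw [labels, ← map_finRange_sigma, ← map_finRange_sigma, ← List.map_coe_finRange_eq_range]
  simp only [indices, List.map_append, List.map_map]
  rfl

theorem nodup_indices : (indices m α β).Nodup := by
  have hsigma (γ : ℕ → ℕ) : ((List.finRange m).sigma fun i => List.finRange (γ i)).Nodup :=
    (List.nodup_finRange m).sigma fun i => List.nodup_finRange (γ i)
  refine .append ((List.nodup_finRange m).map Sum.inl_injective) (.append
    ((hsigma α).map (Sum.inr_injective.comp Sum.inl_injective))
    ((hsigma β).map (Sum.inr_injective.comp Sum.inr_injective)) ?_) ?_ <;>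
  simp [List.Disjoint]

theorem mem_indices (x : Index m α β) : x ∈ indices m α β := by
  rcases x with i | ⟨i, k⟩ | ⟨j, l⟩ <;> simp [indices, List.mem_sigma]

theorem length_labels : (labels m α β).length = (indices m α β).length := by
  rw [← map_label_indices, List.length_map]

/-- The enumeration of the indices. -/
def indexEquiv (m : ℕ) (α β : ℕ → ℕ) : Fin (labels m α β).length ≃ Index m α β :=
  (finCongr length_labels).trans (nodup_indices.getEquivOfForallMemList _ mem_indices)

theorem length_labels_eq_add :
    (labels m α β).length = m + (∑ i : Fin m, α i + ∑ j : Fin m, β j) := by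
  simpa using Fintype.card_congr (indexEquiv m α β)

theorem label_indexEquiv (x : Fin (labels m α β).length) :
    (indexEquiv m α β x).label = (labels m α β)[x] := by
  simp only [← map_label_indices, Fin.getElem_fin, List.getElem_map]
  rfl

theorem indexEquiv_castLE (h : m ≤ (labels m α β).length) (i : Fin m) :
    indexEquiv m α β (Fin.castLE h i) = .inl i := by
  change (indices m α β)[(i : ℕ)]'_ = _
  simp [indices, List.getElem_append_left]

end Labels

section Construction

/-- The entry `(i, j)` of a table, `0` out of range. -/
def tableEntry (T : List (List ℕ)) (i j : ℕ) : ℕ := (T.getD i []).getD j 0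

/-- The coefficients of the digit of index `l` in base `X ^ e` of the entry `(i, j)`. -/
def digitOperands (e i j l : ℕ) : List Operand :=
  (List.range e).map fun k => .coeff i j (l * e + k)

/-- The coefficients of `negXPowAt e α i k y`. -/
def negXPowOperands (e i k : ℕ) (y : ℕ × ℕ) : List Operand :=
  if y.1 = i ∧ y.2 = k then (List.range (e + 1)).map fun k => if k < e then .zero else .negOne
  else []

/-- The coefficients of the entry `(x, y)` of `chain`. -/
def chainOperands (e : ℕ) (x y : ℕ × ℕ) : List Operand :=
  if x = y then [.one] else negXPowOperands e x.1 (x.2 + 1) y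

/-- The coefficients of the entries of the partial linearization of a matrix with the table of
degrees `T`. -/
def linearizationOperands (T : List (List ℕ)) (e : ℕ) (α : ℕ → ℕ) :
    Label → Label → List Operand
  | .inl i, .inl j => digitOperands e i j 0
  | .inl i, .inr (.inl y) => negXPowOperands e i 0 y
  | .inl i, .inr (.inr y) =>
    if tableEntry T i y.1 < (α i + 1) * e then [] else digitOperands e i y.1 (y.2 + 1)
  | .inr (.inl x), .inl j =>
    if tableEntry T x.1 j < (α x.1 + 1) * e then digitOperands e x.1 j (x.2 + 1) else []
  | .inr (.inl x), .inr (.inl y) => chainOperands e x y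
  | .inr (.inl _), .inr (.inr _) => []
  | .inr (.inr x), .inl j => negXPowOperands e j 0 x
  | .inr (.inr _), .inr (.inl _) => []
  | .inr (.inr x), .inr (.inr y) => chainOperands e y x

/-- The shift that is `s` on the given columns, and `t` on the others. -/
def labelShift (s : List ℤ) (t : ℤ) : Label → ℤ
  | .inl i => s.getD i 0
  | .inr _ => t

/-- The partial linearization, with base `X ^ e`, of an `m × m` matrix with the table of degrees
`T`, and the extension of the shift `s` by `t`. -/
def linearizationConstruction (m : ℕ) (T : List (List ℕ)) (s : List ℤ) (t : ℤ) (e : ℕ)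
    (α β : ℕ → ℕ) : Construction where
  steps := []
  dim := (labels m α β).length
  shift := (labels m α β).map (labelShift s t)
  entries := (labels m α β).map fun x => (labels m α β).map (linearizationOperands T e α x)

variable {K : Type*} [Field K] {m : ℕ} {A : Matrix (Fin m) (Fin m) K[X]} {e : ℕ} {α β : ℕ → ℕ}

/-- The entries of `A` that are expanded along their rows: those in the row `i` that have at most
`α i + 1` digits in base `X ^ e`. -/
def rowPart (e : ℕ) (α : ℕ → ℕ) (A : Matrix (Fin m) (Fin m) K[X]) : Matrix (Fin m) (Fin m) K[X] :=
  Matrix.of fun i j => if (A i j).natDegree < (α i + 1) * e then A i j else 0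

/-- The entries of `A` that are expanded along their columns. -/
def columnPart (e : ℕ) (α : ℕ → ℕ) (A : Matrix (Fin m) (Fin m) K[X]) :
    Matrix (Fin m) (Fin m) K[X] :=
  Matrix.of fun i j => if (A i j).natDegree < (α i + 1) * e then 0 else A i j

theorem rowPart_add_columnPart : rowPart e α A + columnPart e α A = A := by
  ext1 i j
  rw [Matrix.add_apply, rowPart, columnPart, Matrix.of_apply, Matrix.of_apply]
  split_ifs <;> simp

theorem tableEntry_degreeTable (A : Matrix (Fin m) (Fin m) K[X]) (i j : Fin m) :
    tableEntry (degreeTable A) i j = (A i j).natDegree := by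
  simp [tableEntry, degreeTable, List.getD_eq_getElem?_getD]

theorem ofCoeffs_map_range (f : ℕ → K) (n : ℕ) :
    ofCoeffs ((List.range n).map f) = ∑ k ∈ Finset.range n, C (f k) * X ^ k := by
  unfold ofCoeffs
  rw [List.length_map, List.length_range]
  refine Finset.sum_congr rfl fun k hk => ?_
  simp [List.getD_eq_getElem?_getD, Finset.mem_range.1 hk]

variable {r : List K}

theorem ofCoeffs_digitOperands (e : ℕ) (i j : Fin m) (l : ℕ) :
    ofCoeffs ((digitOperands e i j l).map (Operand.value A r)) = digit e l (A i j) := by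
  rw [digitOperands, List.map_map, ofCoeffs_map_range, digit]
  simp [Operand.value]

theorem ofCoeffs_negXPowOperands (x : Σ i : Fin m, Fin (α i)) (i : Fin m) (k : ℕ) :
    ofCoeffs ((negXPowOperands e i k (pairLabel x)).map (Operand.value A r)) =
      negXPowAt K e (fun i : Fin m => α i) i k x := by
  rw [negXPowOperands, negXPowAt]
  simp only [pairLabel, Fin.val_inj]
  split_ifs
  · rw [List.map_map, ofCoeffs_map_range, Finset.sum_range_succ, Finset.sum_eq_zero fun k hk => by
      simp [Finset.mem_range.1 hk, Operand.value]]
    simp [Operand.value]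
  · rfl

theorem ofCoeffs_chainOperands (x y : Σ i : Fin m, Fin (α i)) :
    ofCoeffs ((chainOperands e (pairLabel x) (pairLabel y)).map (Operand.value A r)) =
      chain K e (fun i : Fin m => α i) x y := by
  rw [chainOperands, chain, Matrix.add_apply, Matrix.one_apply]
  simp only [pairLabel_injective.eq_iff, Matrix.of_apply]
  split_ifs with hxy
  · subst hxy
    simp [ofCoeffs, negXPowAt, Operand.value]
  · rw [zero_add]
    exact ofCoeffs_negXPowOperands y x.1 (x.2 + 1)

theorem ofCoeffs_linearizationOperands (x y : Index m α β) :
    ofCoeffs ((linearizationOperands (degreeTable A) e α x.label y.label).map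
      (Operand.value A r)) =
    linearization e (fun i : Fin m => α i) (fun j : Fin m => β j) (rowPart e α A)
      (columnPart e α A) x y := by
  have hnil : ofCoeffs (([] : List Operand).map (Operand.value A r)) = 0 := by simp [ofCoeffs]
  rcases x with i | x | x <;> rcases y with j | y | y <;>
    simp only [Index.label, Sum.map_inl, Sum.map_inr, linearizationOperands, linearization, chains,
      Matrix.fromBlocks_apply₁₁, Matrix.fromBlocks_apply₁₂, Matrix.fromBlocks_apply₂₁,
      Matrix.fromBlocks_apply₂₂, Matrix.fromCols_apply_inl, Matrix.fromCols_apply_inr,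
      Matrix.fromRows_apply_inl, Matrix.fromRows_apply_inr, Matrix.transpose_apply,
      rowPart_add_columnPart, Matrix.map_apply, Matrix.zero_apply, hnil]
  · exact ofCoeffs_digitOperands e i j 0
  · exact ofCoeffs_negXPowOperands y i 0
  · rw [pairLabel, tableEntry_degreeTable, highDigits, Matrix.of_apply, Matrix.transpose_apply,
      columnPart, Matrix.of_apply]
    split_ifs
    · rw [digit_zero_right, hnil]
    · exact ofCoeffs_digitOperands e i y.1 (y.2 + 1)
  · rw [pairLabel, tableEntry_degreeTable, highDigits, Matrix.of_apply, rowPart, Matrix.of_apply]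
    split_ifs
    · exact ofCoeffs_digitOperands e x.1 j (x.2 + 1)
    · rw [digit_zero_right, hnil]
  · exact ofCoeffs_chainOperands x y
  · exact ofCoeffs_negXPowOperands x j 0
  · exact ofCoeffs_chainOperands y x

theorem matrix_linearizationConstruction (s : List ℤ) (t : ℤ) :
    (linearizationConstruction m (degreeTable A) s t e α β).matrix A =
      (linearization e (fun i : Fin m => α i) (fun j : Fin m => β j) (rowPart e α A)
        (columnPart e α A)).submatrix (indexEquiv m α β) (indexEquiv m α β) := by
  funext (x : Fin (labels m α β).length) (y : Fin (labels m α β).length)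
  refine Eq.trans ?_ (ofCoeffs_linearizationOperands (r := []) _ _)
  rw [label_indexEquiv, label_indexEquiv]
  change ofCoeffs ((((linearizationConstruction m (degreeTable A) s t e α β).entries.getD x []).getD
    y []).map (Operand.value A [])) = _
  simp [linearizationConstruction, List.getD_eq_getElem?_getD]

theorem shiftFun_linearizationConstruction (T : List (List ℕ)) (s : List ℤ) (t : ℤ)
    (x : Fin (labels m α β).length) :
    (linearizationConstruction m T s t e α β).shiftFun x =
      labelShift s t (indexEquiv m α β x).label := by
  simp [label_indexEquiv, Construction.shiftFun, linearizationConstruction,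
    List.getD_eq_getElem?_getD]

theorem natDegree_rowPart_lt (he : 0 < e) (i j : Fin m) :
    (rowPart e α A i j).natDegree < (α i + 1) * e := by
  rw [rowPart, Matrix.of_apply]
  split_ifs with h
  · exact h
  · simpa using he

theorem natDegree_columnPart_lt (he : 0 < e) (i : Fin m) {j : Fin m}
    (h : (A i j).natDegree < (α i + 1) * e ∨ (A i j).natDegree < (β j + 1) * e) :
    (columnPart e α A i j).natDegree < (β j + 1) * e := by
  rw [columnPart, Matrix.of_apply]
  split_ifs with hrow
  · simpa using he
  · exact h.resolve_left hrow

theorem det_linearizationConstruction_ne_zero (hA : A.det ≠ 0) (he : 0 < e)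
    (h : ∀ i j, (A i j).natDegree < (α i + 1) * e ∨ (A i j).natDegree < (β j + 1) * e)
    (s : List ℤ) (t : ℤ) :
    ((linearizationConstruction m (degreeTable A) s t e α β).matrix A).det ≠ 0 := by
  rw [matrix_linearizationConstruction]
  refine ne_of_eq_of_ne (Matrix.det_submatrix_equiv_self (indexEquiv m α β) _) ?_
  refine det_linearization_ne_zero (natDegree_rowPart_lt he)
    (fun i j => natDegree_columnPart_lt he i (h i j)) ?_
  rwa [rowPart_add_columnPart]

theorem matDegree_linearizationConstruction_le {δ : ℕ} (hδ : e - 1 ≤ δ)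
    (hextra : m < (labels m α β).length → e ≤ δ) (s : List ℤ) (t : ℤ) :
    matDegree ((linearizationConstruction m (degreeTable A) s t e α β).matrix A) ≤ δ := by
  rw [matrix_linearizationConstruction]
  refine Finset.sup_le fun x _ => natDegree_linearization_le hδ (fun hne => hextra ?_) _ _
  have hcard := Fintype.card_pos_iff.2 hne
  rw [length_labels_eq_add]
  simpa using hcard

theorem exists_isPopovFormOf_linearizationConstruction {s : Fin m → ℤ} {t : ℤ} (hA : A.det ≠ 0)
    (he : 0 < e)
    (h : ∀ i j, (A i j).natDegree < (α i + 1) * e ∨ (A i j).natDegree < (β j + 1) * e)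
    (ht : ∀ k, A.det.natDegree + s k ≤ t) {c : Construction}
    (hc : c = linearizationConstruction m (degreeTable A) (List.ofFn s) t e α β) :
    ∃ (hm : m ≤ c.dim) (P : Matrix (Fin c.dim) (Fin c.dim) K[X]),
      IsPopovFormOf c.shiftFun (c.matrix A) P ∧
      IsPopovFormOf s A (P.submatrix (Fin.castLE hm) (Fin.castLE hm)) := by
  subst hc
  have hm : m ≤ (labels m α β).length := by rw [length_labels_eq_add]; exact Nat.le_add_right _ _
  obtain ⟨P, hP⟩ := exists_isPopovFormOf s hA
  have hP' : IsPopovFormOf s (rowPart e α A + columnPart e α A) P := by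
    rwa [rowPart_add_columnPart]
  have hu (i : Fin m) :
      labelShift (List.ofFn s) t (indexEquiv m α β (Fin.castLE hm i)).label = s i := by
    simp [indexEquiv_castLE, Index.label, labelShift, List.getD_eq_getElem?_getD]
  have hlarge (k : Fin m) (x) : (P k k).natDegree + s k ≤
      labelShift (List.ofFn s) t (indexEquiv m α β ((indexEquiv m α β).symm (.inr x))).label := by
    rw [Equiv.apply_symm_apply]
    have hdiag : ((P k k).natDegree : ℤ) ≤ A.det.natDegree := mod_cast hP.natDegree_diag_le hA k
    exact (add_le_add_left hdiag (s k)).trans (ht k)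
  obtain ⟨Q, hQ, hQP⟩ := exists_isPopovFormOf_linearization
    (u := fun x => labelShift (List.ofFn s) t (indexEquiv m α β x).label)
    (α := fun i : Fin m => α i) (β := fun j : Fin m => β j)
    (natDegree_rowPart_lt he) (fun i j => natDegree_columnPart_lt he i (h i j))
    (by rwa [rowPart_add_columnPart]) hP' (indexEquiv_castLE hm) hu hlarge
  refine ⟨hm, Q, ?_, hQP ▸ hP⟩
  rw [matrix_linearizationConstruction,
    show Construction.shiftFun _ = _ from
      funext (shiftFun_linearizationConstruction (degreeTable A) (List.ofFn s) t)]
  exact hQ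

end Construction

section DominantPermutation

variable {ι : Type*} {d : ι → ι → ℕ} {π : Equiv.Perm ι} {e : ℕ}

/-- `π` is a dominant permutation for `d`: each entry `d i j` is at most the entry that `π` selects
in the row `i`, or at most the one that it selects in the column `j`. -/
def IsDominant (d : ι → ι → ℕ) (π : Equiv.Perm ι) : Prop :=
  ∀ i j, d i j ≤ max (d i (π i)) (d (π.symm j) j)

theorem exists_isDominant [Finite ι] (d : ι → ι → ℕ) : ∃ π, IsDominant d π := by
  classical
  have := Fintype.ofFinite ι
  -- With the weights `2 ^ d i j`, an entry that exceeds `d i (π i)` and `d k (π k)` outweighs both.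
  obtain ⟨π, -, hπ⟩ := Finset.exists_max_image Finset.univ
    (fun π : Equiv.Perm ι => ∑ i, 2 ^ d i (π i)) ⟨1, Finset.mem_univ _⟩
  refine ⟨π, fun i j => ?_⟩
  obtain ⟨k, rfl⟩ := π.surjective j
  rw [Equiv.symm_apply_apply]
  by_contra! hlt
  obtain ⟨hi, hk⟩ := max_lt_iff.1 hlt
  have hik : i ≠ k := by
    rintro rfl
    exact hi.false
  have hrest : ∑ x ∈ {i, k}ᶜ, 2 ^ d x ((π * Equiv.swap i k) x) = ∑ x ∈ {i, k}ᶜ, 2 ^ d x (π x) := by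
    refine Finset.sum_congr rfl fun x hx => ?_
    simp only [Finset.mem_compl, Finset.mem_insert, Finset.mem_singleton, not_or] at hx
    rw [Equiv.Perm.mul_apply, Equiv.swap_apply_of_ne_of_ne hx.1 hx.2]
  have hswap : 2 ^ d i (π k) + 2 ^ d k (π i) ≤ 2 ^ d i (π i) + 2 ^ d k (π k) := by
    have h := hπ (π * Equiv.swap i k) (Finset.mem_univ _)
    rw [← Finset.sum_add_sum_compl {i, k}, ← Finset.sum_add_sum_compl {i, k}, hrest,
      Finset.sum_pair hik, Finset.sum_pair hik] at h
    simpa using h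
  have hi' : 2 ^ (d i (π i) + 1) ≤ 2 ^ d i (π k) := Nat.pow_le_pow_right two_pos hi
  have hk' : 2 ^ (d k (π k) + 1) ≤ 2 ^ d i (π k) := Nat.pow_le_pow_right two_pos hk
  have hpos : 0 < 2 ^ d k (π i) := Nat.two_pow_pos _
  omega

theorem IsDominant.lt_or_lt (h : IsDominant d π) (he : 0 < e) (i j : ι) :
    d i j < (d i (π i) / e + 1) * e ∨ d i j < (d (π.symm j) j / e + 1) * e := by
  have hlt (a : ℕ) : a < (a / e + 1) * e := by
    rw [add_one_mul]
    exact Nat.lt_div_mul_add he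
  exact (le_max_iff.1 (h i j)).imp (fun h => h.trans_lt (hlt _)) fun h => h.trans_lt (hlt _)

theorem sum_div_le [Fintype ι] {a : ι → ℕ} {n : ℕ} (h : ∑ i, a i ≤ n * e) (he : 0 < e) :
    ∑ i, a i / e ≤ n := by
  refine Nat.le_of_mul_le_mul_right ?_ he
  rw [Finset.sum_mul]
  exact (Finset.sum_le_sum fun i _ => Nat.div_mul_le_self (a i) e).trans h

end DominantPermutation

section Plan

/-- `p` is the list of the values of a dominant permutation for the table `T`; the inverse
permutation is then `p.idxOf`. -/
def IsDominantList (T : List (List ℕ)) (p : List ℕ) : Prop :=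
  ∀ i < T.length, p.getD i 0 < T.length ∧ p.idxOf (p.getD i 0) = i ∧
    ∀ j < T.length,
      tableEntry T i j ≤ max (tableEntry T i (p.getD i 0)) (tableEntry T (p.idxOf j) j)

variable {T : List (List ℕ)} {p : List ℕ} {m : ℕ}

theorem exists_isDominantList (T : List (List ℕ)) : ∃ p, IsDominantList T p := by
  obtain ⟨π, hπ⟩ := exists_isDominant fun i j : Fin T.length => tableEntry T i j
  set p := List.ofFn fun i => (π i : ℕ) with hp
  have hget (i : Fin T.length) : p.getD i 0 = π i := by simp [hp, List.getD_eq_getElem?_getD]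
  have hidx (i : Fin T.length) : p.idxOf (π i : ℕ) = i := by
    have hnodup : p.Nodup := List.nodup_ofFn.2 (Fin.val_injective.comp π.injective)
    simpa [hp] using hnodup.idxOf_getElem i (by simp [hp])
  refine ⟨p, fun i hi => ?_⟩
  lift i to Fin T.length using hi
  rw [hget]
  refine ⟨(π i).2, hidx i, fun j hj => ?_⟩
  lift j to Fin T.length using hj
  have hj := hidx (π.symm j)
  rw [Equiv.apply_symm_apply] at hj
  rw [hj]
  exact hπ i j

theorem IsDominantList.exists_perm (h : IsDominantList T p) (hT : T.length = m) :
    ∃ π : Equiv.Perm (Fin m), IsDominant (fun i j : Fin m => tableEntry T i j) π ∧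
      (∀ i : Fin m, p.getD i 0 = π i) ∧ ∀ j : Fin m, p.idxOf (j : ℕ) = π.symm j := by
  subst hT
  let f (i : Fin T.length) : Fin T.length := ⟨p.getD i 0, (h i i.2).1⟩
  have hf : Function.Injective f := fun i j hij => Fin.ext <| by
    rw [← (h i i.2).2.1, ← (h j j.2).2.1]
    exact congrArg p.idxOf (congrArg Fin.val hij)
  let π := Equiv.ofBijective f (Finite.injective_iff_bijective.1 hf)
  have hsymm (j : Fin T.length) : p.idxOf (j : ℕ) = π.symm j := by
    obtain ⟨i, rfl⟩ := π.surjective j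
    rw [Equiv.symm_apply_apply]
    exact (h i i.2).2.1
  refine ⟨π, fun i j => ?_, fun i => rfl, hsymm⟩
  have hij := (h i i.2).2.2 j j.2
  rwa [hsymm] at hij

instance decidableRel_isDominantList :
    DecidableRel fun (T : List (List ℕ)) (n : ℕ) =>
      IsDominantList T ((Encodable.decode n).getD []) := fun T n => by
  unfold IsDominantList
  infer_instance

theorem exists_isDominantList_decode (T : List (List ℕ)) :
    ∃ n, IsDominantList T ((Encodable.decode n).getD []) := by
  obtain ⟨p, hp⟩ := exists_isDominantList T
  exact ⟨Encodable.encode p, by simpa using hp⟩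

/-- The first list, in the order of the codes of lists, that is dominant for `T`. -/
def dominantList (T : List (List ℕ)) : List ℕ :=
  (Encodable.decode (Nat.find (exists_isDominantList_decode T))).getD []

theorem isDominantList_dominantList (T : List (List ℕ)) : IsDominantList T (dominantList T) :=
  Nat.find_spec (exists_isDominantList_decode T)

/-- The entry of `T` that the permutation with the list of values `p` selects in the row `i`. -/
def rowDegree (T : List (List ℕ)) (p : List ℕ) (i : ℕ) : ℕ := tableEntry T i (p.getD i 0)

/-- The entry of `T` that the permutation with the list of values `p` selects in the column `j`. -/
def columnDegree (T : List (List ℕ)) (p : List ℕ) (j : ℕ) : ℕ := tableEntry T (p.idxOf j) j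

/-- The number of coefficients of a digit: the least positive one, `e`, such that the sum of the
degrees that `p` selects is at most `T.length * e`. -/
def digitLength (T : List (List ℕ)) (p : List ℕ) : ℕ :=
  (((List.range T.length).map (rowDegree T p)).sum - 1) / T.length + 1

/-- A bound for `A.det.natDegree + s k`, where `T` is the table of degrees of `A`. -/
def largeShift (T : List (List ℕ)) (s : List ℤ) : ℤ :=
  ((T.map List.sum).sum + (s.map Int.natAbs).sum : ℕ)

/-- The partial linearization relative to the permutation with the list of values `p`. -/
def planOf (T : List (List ℕ)) (s : List ℤ) (p : List ℕ) : Construction :=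
  linearizationConstruction T.length T s (largeShift T s) (digitLength T p)
    (fun i => rowDegree T p i / digitLength T p) fun j => columnDegree T p j / digitLength T p

/-- The partial linearization relative to a dominant permutation for the table of degrees. -/
def plan (a : List (List ℕ) × List ℤ) : Construction :=
  planOf a.1 a.2 (dominantList a.1)

variable {K : Type*} [Field K]

theorem natDegree_det_le_sum {ι R : Type*} [Fintype ι] [DecidableEq ι] [CommRing R]
    (A : Matrix ι ι R[X]) : A.det.natDegree ≤ ∑ i, ∑ j, (A i j).natDegree := by
  rw [← Matrix.det_transpose, Matrix.det_apply']
  refine natDegree_sum_le_of_forall_le _ _ fun π _ => ?_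
  calc _ ≤ (∏ i, A i (π i)).natDegree := by
        refine natDegree_mul_le.trans ?_
        rw [natDegree_intCast, zero_add]
        rfl
    _ ≤ ∑ i, (A i (π i)).natDegree := natDegree_prod_le _ _
    _ ≤ ∑ i, ∑ j, (A i j).natDegree := Finset.sum_le_sum fun i _ =>
        Finset.single_le_sum (f := fun j => (A i j).natDegree) (fun _ _ => Nat.zero_le _)
          (Finset.mem_univ (π i))

theorem natDegree_det_add_le_largeShift (A : Matrix (Fin m) (Fin m) K[X]) (s : Fin m → ℤ)
    (k : Fin m) : A.det.natDegree + s k ≤ largeShift (degreeTable A) (List.ofFn s) := by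
  have hdet : A.det.natDegree ≤ ((degreeTable A).map List.sum).sum := by
    simpa [degreeTable, List.sum_ofFn, List.map_ofFn] using natDegree_det_le_sum A
  have hs : (s k).natAbs ≤ ((List.ofFn s).map Int.natAbs).sum :=
    List.le_sum_of_mem (List.mem_map_of_mem (List.mem_ofFn.2 ⟨k, rfl⟩))
  rw [largeShift]
  omega

theorem length_degreeTable (A : Matrix (Fin m) (Fin m) K[X]) : (degreeTable A).length = m := by
  simp [degreeTable]

theorem exists_isDominant_dominantList (A : Matrix (Fin m) (Fin m) K[X]) :
    ∃ π, IsDominant (fun i j => (A i j).natDegree) π ∧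
      (∀ i : Fin m, rowDegree (degreeTable A) (dominantList (degreeTable A)) i =
        (A i (π i)).natDegree) ∧
      ∀ j : Fin m, columnDegree (degreeTable A) (dominantList (degreeTable A)) j =
        (A (π.symm j) j).natDegree := by
  obtain ⟨π, hπ, hget, hidx⟩ :=
    (isDominantList_dominantList (degreeTable A)).exists_perm (length_degreeTable A)
  simp only [tableEntry_degreeTable] at hπ
  refine ⟨π, hπ, fun i => ?_, fun j => ?_⟩
  · rw [rowDegree, hget, tableEntry_degreeTable]
  · rw [columnDegree, hidx, tableEntry_degreeTable]

theorem le_mul_pred_div_add_one (S : ℕ) {m : ℕ} (hm : 0 < m) : S ≤ m * ((S - 1) / m + 1) :=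
  Nat.le_of_pred_lt (Nat.lt_mul_div_succ _ hm)

theorem pred_div_add_one_le_ceil {S σ : ℕ} (hS : S ≤ σ) (hpos : 0 < S) (hm : 0 < m) :
    (S - 1) / m + 1 ≤ ⌈(σ : ℚ) / m⌉₊ := by
  refine Nat.lt_ceil.2 ((lt_div_iff₀ (mod_cast hm)).2 ?_)
  have := Nat.div_mul_le_self (S - 1) m
  exact_mod_cast (by omega : (S - 1) / m * m < σ)

theorem digitLength_eq (hT : T.length = m) :
    digitLength T p = (∑ i : Fin m, rowDegree T p i - 1) / m + 1 := by
  rw [digitLength, hT, ← List.map_coe_finRange_eq_range, List.map_map, ← List.ofFn_eq_map,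
    List.sum_ofFn]
  rfl

theorem exists_plan_eq (hm : 0 < m) (A : Matrix (Fin m) (Fin m) K[X]) (s : Fin m → ℤ) :
    ∃ (e : ℕ) (α β : ℕ → ℕ), plan (degreeTable A, List.ofFn s) =
        linearizationConstruction m (degreeTable A) (List.ofFn s)
          (largeShift (degreeTable A) (List.ofFn s)) e α β ∧
      0 < e ∧
      (∀ i j : Fin m,
        (A i j).natDegree < (α i + 1) * e ∨ (A i j).natDegree < (β j + 1) * e) ∧
      (labels m α β).length ≤ 3 * m ∧
      e - 1 ≤ ⌈(genericDetBound A : ℚ) / m⌉₊ ∧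
      (m < (labels m α β).length → e ≤ ⌈(genericDetBound A : ℚ) / m⌉₊) := by
  obtain ⟨π, hπ, hrow, hcol⟩ := exists_isDominant_dominantList A
  set T := degreeTable A
  set p := dominantList T
  set S := ∑ i, (A i (π i)).natDegree
  obtain ⟨e, he⟩ : ∃ e, e = digitLength T p := ⟨_, rfl⟩
  have heS : e = (S - 1) / m + 1 := by
    simpa only [hrow] using he.trans (digitLength_eq (length_degreeTable A))
  have he0 : 0 < e := heS ▸ Nat.succ_pos _
  have hSe : S ≤ m * e := heS ▸ le_mul_pred_div_add_one S hm
  have hSσ : S ≤ genericDetBound A :=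
    Finset.le_sup (f := fun π : Equiv.Perm (Fin m) => ∑ i, (A i (π i)).natDegree)
      (Finset.mem_univ π)
  have hceil (hS : 0 < S) : e ≤ ⌈(genericDetBound A : ℚ) / m⌉₊ :=
    heS.trans_le (pred_div_add_one_le_ceil hSσ hS hm)
  have hlength {n : ℕ} (h : S ≤ n * e) :
      (labels m (rowDegree T p · / e) (columnDegree T p · / e)).length ≤ m + (n + n) := by
    simp only [length_labels_eq_add, hrow, hcol]
    gcongr
    · exact sum_div_le h he0
    · refine sum_div_le ?_ he0
      rw [← Equiv.sum_comp π]
      simpa only [Equiv.symm_apply_apply] using h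
  refine ⟨e, (rowDegree T p · / e), (columnDegree T p · / e), ?_, he0, fun i j => ?_,
    (hlength hSe).trans (by omega), ?_, fun h => hceil (Nat.pos_of_ne_zero fun hS => ?_)⟩
  · rw [plan, planOf, length_degreeTable, he]
  · simpa only [hrow, hcol] using hπ.lt_or_lt he0 i j
  · rcases Nat.eq_zero_or_pos S with hS | hS
    · simp [heS, hS]
    · exact (Nat.sub_le e 1).trans (hceil hS)
  · exact h.not_ge (hlength (n := 0) (by omega))

end Plan

section Computability

open Primrec

variable {γ : Type} [Primcodable γ]

theorem primrec_sum : Primrec (List.sum : List ℕ → ℕ) :=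
  (list_foldr (h := fun _ x => x.1 + x.2) .id (.const 0)
    (nat_add.comp (fst.comp snd) (snd.comp snd))).of_eq fun _ => rfl

theorem primrec_natCast_int : Primrec ((↑) : ℕ → ℤ) :=
  encode_iff.1 ((nat_mul.comp (.const 2) .id).of_eq fun _ => rfl)

theorem primrec_natAbs : Primrec Int.natAbs := by
  refine (nat_div.comp (Primrec.succ.comp Primrec.encode) (.const 2)).of_eq fun z => ?_
  rcases z with n | n
  · change (2 * n + 1) / 2 = n
    omega
  · change (2 * n + 1 + 1) / 2 = n + 1
    omega

theorem primrec_tableEntry {T : γ → List (List ℕ)} {i j : γ → ℕ} (hT : Primrec T)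
    (hi : Primrec i) (hj : Primrec j) : Primrec fun c => tableEntry (T c) (i c) (j c) :=
  (list_getD 0).comp ((list_getD []).comp hT hi) hj

theorem primrecPred_forall_lt {n : γ → ℕ} (hn : Primrec n) {R : ℕ → γ → Prop}
    (hR : PrimrecRel R) : PrimrecPred fun c => ∀ x < n c, R x c :=
  (hR.forall_mem_list.comp (list_range.comp hn) .id).of_eq fun c => by
    simp only [List.mem_range, id]

theorem primrec_labels {m : γ → ℕ} {α β : γ → ℕ → ℕ} (hm : Primrec m) (hα : Primrec₂ α)
    (hβ : Primrec₂ β) : Primrec fun c => labels (m c) (α c) (β c) := by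
  have hrange : Primrec fun c => List.range (m c) := list_range.comp hm
  have hpairs {δ : γ → ℕ → ℕ} (hδ : Primrec₂ δ) : Primrec fun c => pairs (m c) (δ c) :=
    list_flatMap hrange (list_map (list_range.comp hδ) (Primrec.pair (snd.comp fst) snd))
  exact list_append.comp (list_map hrange (sumInl.comp snd)) (list_append.comp
    (list_map (hpairs hα) (sumInr.comp (sumInl.comp snd)))
    (list_map (hpairs hβ) (sumInr.comp (sumInr.comp snd))))

theorem primrec_digitOperands {e i j l : γ → ℕ} (he : Primrec e) (hi : Primrec i)
    (hj : Primrec j) (hl : Primrec l) :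
    Primrec fun c => digitOperands (e c) (i c) (j c) (l c) := by
  have hcoeff : Primrec fun x : ℕ × ℕ × ℕ => Operand.coeff x.1 x.2.1 x.2.2 :=
    (of_equiv_symm (e := Operand.equiv)).comp (sumInl.comp sumInr)
  exact list_map (list_range.comp he) (hcoeff.comp (.pair (hi.comp fst) (.pair (hj.comp fst)
    (nat_add.comp (nat_mul.comp (hl.comp fst) (he.comp fst)) snd))))

theorem primrec_negXPowOperands {e i k : γ → ℕ} {y : γ → ℕ × ℕ} (he : Primrec e)
    (hi : Primrec i) (hk : Primrec k) (hy : Primrec y) :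
    Primrec fun c => negXPowOperands (e c) (i c) (k c) (y c) :=
  Primrec.ite ((Primrec.eq.comp (fst.comp hy) hi).and (Primrec.eq.comp (snd.comp hy) hk))
    (list_map (list_range.comp (Primrec.succ.comp he))
      (Primrec.ite (nat_lt.comp snd (he.comp fst)) (.const _) (.const _)))
    (.const [])

theorem primrec_chainOperands {e : γ → ℕ} {x y : γ → ℕ × ℕ} (he : Primrec e)
    (hx : Primrec x) (hy : Primrec y) : Primrec fun c => chainOperands (e c) (x c) (y c) :=
  Primrec.ite (Primrec.eq.comp hx hy) (.const _)
    (primrec_negXPowOperands he (fst.comp hx) (Primrec.succ.comp (snd.comp hx)) hy)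

theorem primrec_sumElim {δ δ' σ : Type} [Primcodable δ] [Primcodable δ'] [Primcodable σ]
    {f : γ → δ ⊕ δ'} {F : γ → δ ⊕ δ' → σ} (hf : Primrec f)
    (hl : Primrec fun z : γ × δ => F z.1 (.inl z.2))
    (hr : Primrec fun z : γ × δ' => F z.1 (.inr z.2)) : Primrec fun c => F c (f c) :=
  (sumCasesOn hf hl.to₂ hr.to₂).of_eq fun c => by cases f c <;> rfl

theorem primrec_labelElim {σ : Type} [Primcodable σ] {x : γ → Label} {F : γ → Label → σ}
    (hx : Primrec x) (h₁ : Primrec fun z : γ × ℕ => F z.1 (.inl z.2))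
    (h₂ : Primrec fun z : γ × ℕ × ℕ => F z.1 (.inr (.inl z.2)))
    (h₃ : Primrec fun z : γ × ℕ × ℕ => F z.1 (.inr (.inr z.2))) : Primrec fun c => F c (x c) :=
  primrec_sumElim hx h₁ (primrec_sumElim (F := fun z y => F z.1 (.inr y)) snd
    (h₂.comp (.pair (fst.comp fst) snd)) (h₃.comp (.pair (fst.comp fst) snd)))

section

variable {T : γ → List (List ℕ)} {e : γ → ℕ} {α : γ → ℕ → ℕ} {x y : γ → Label} {i : γ → ℕ}
  {p : γ → ℕ × ℕ}

theorem primrecPred_tableEntry_lt {i j : γ → ℕ} (hT : Primrec T) (he : Primrec e)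
    (hα : Primrec₂ α) (hi : Primrec i) (hj : Primrec j) :
    PrimrecPred fun c => tableEntry (T c) (i c) (j c) < (α c (i c) + 1) * e c :=
  nat_lt.comp (primrec_tableEntry hT hi hj)
    (nat_mul.comp (Primrec.succ.comp (hα.comp .id hi)) he)

theorem primrec_linearizationOperands_inl (hT : Primrec T) (he : Primrec e)
    (hα : Primrec₂ α) (hi : Primrec i) (hy : Primrec y) :
    Primrec fun c => linearizationOperands (T c) (e c) (α c) (.inl (i c)) (y c) :=
  have he' {δ : Type} [Primcodable δ] : Primrec fun z : γ × δ => e z.1 := he.comp fst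
  have hi' {δ : Type} [Primcodable δ] : Primrec fun z : γ × δ => i z.1 := hi.comp fst
  have hlow := primrecPred_tableEntry_lt (hT.comp fst) he' (hα.comp₂ (fst.comp fst).to₂ .right)
    hi' (fst.comp snd)
  primrec_labelElim hy (primrec_digitOperands he' hi' snd (.const 0))
    (primrec_negXPowOperands he' hi' (.const 0) snd)
    (.ite hlow (.const [])
      (primrec_digitOperands he' hi' (fst.comp snd) (Primrec.succ.comp (snd.comp snd))))

theorem primrec_linearizationOperands_inr_inl (hT : Primrec T) (he : Primrec e)
    (hα : Primrec₂ α) (hp : Primrec p) (hy : Primrec y) :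
    Primrec fun c => linearizationOperands (T c) (e c) (α c) (.inr (.inl (p c))) (y c) :=
  have he' {δ : Type} [Primcodable δ] : Primrec fun z : γ × δ => e z.1 := he.comp fst
  have hp' {δ : Type} [Primcodable δ] : Primrec fun z : γ × δ => p z.1 := hp.comp fst
  have hlow := primrecPred_tableEntry_lt (hT.comp fst) he' (hα.comp₂ (fst.comp fst).to₂ .right)
    (fst.comp hp') snd
  primrec_labelElim hy
    (.ite hlow
      (primrec_digitOperands he' (fst.comp hp') snd (Primrec.succ.comp (snd.comp hp')))
      (.const []))
    (primrec_chainOperands he' hp' snd) (.const [])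

theorem primrec_linearizationOperands_inr_inr (he : Primrec e) (hp : Primrec p)
    (hy : Primrec y) :
    Primrec fun c => linearizationOperands (T c) (e c) (α c) (.inr (.inr (p c))) (y c) :=
  primrec_labelElim (F := fun c => linearizationOperands (T c) (e c) (α c) (.inr (.inr (p c)))) hy
    (primrec_negXPowOperands (he.comp fst) snd (.const 0) (hp.comp fst)) (.const [])
    (primrec_chainOperands (he.comp fst) snd (hp.comp fst))

theorem primrec_linearizationOperands (hT : Primrec T) (he : Primrec e) (hα : Primrec₂ α)
    (hx : Primrec x) (hy : Primrec y) :
    Primrec fun c => linearizationOperands (T c) (e c) (α c) (x c) (y c) :=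
  have hα' {δ : Type} [Primcodable δ] : Primrec₂ fun z : γ × δ => α z.1 :=
    hα.comp₂ (fst.comp fst).to₂ .right
  primrec_labelElim (F := fun c x => linearizationOperands (T c) (e c) (α c) x (y c)) hx
    (primrec_linearizationOperands_inl (hT.comp fst) (he.comp fst) hα' snd (hy.comp fst))
    (primrec_linearizationOperands_inr_inl (hT.comp fst) (he.comp fst) hα' snd (hy.comp fst))
    (primrec_linearizationOperands_inr_inr (he.comp fst) snd (hy.comp fst))

end

theorem primrec_labelShift {s : γ → List ℤ} {t : γ → ℤ} {x : γ → Label} (hs : Primrec s)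
    (ht : Primrec t) (hx : Primrec x) : Primrec fun c => labelShift (s c) (t c) (x c) :=
  primrec_sumElim (F := fun c => labelShift (s c) (t c)) hx
    ((list_getD 0).comp (hs.comp fst) snd) (ht.comp fst)

theorem primrec_linearizationConstruction {m : γ → ℕ} {T : γ → List (List ℕ)}
    {s : γ → List ℤ} {t : γ → ℤ} {e : γ → ℕ} {α β : γ → ℕ → ℕ} (hm : Primrec m) (hT : Primrec T)
    (hs : Primrec s) (ht : Primrec t) (he : Primrec e) (hα : Primrec₂ α) (hβ : Primrec₂ β) :
    Primrec fun c => linearizationConstruction (m c) (T c) (s c) (t c) (e c) (α c) (β c) := by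
  have hlabels := primrec_labels hm hα hβ
  have hshift : Primrec fun c => (labels (m c) (α c) (β c)).map (labelShift (s c) (t c)) :=
    list_map hlabels (primrec_labelShift (hs.comp fst) (ht.comp fst) snd)
  have hentries : Primrec fun c => (labels (m c) (α c) (β c)).map fun x =>
      (labels (m c) (α c) (β c)).map (linearizationOperands (T c) (e c) (α c) x) :=
    list_map hlabels (list_map (hlabels.comp fst) (primrec_linearizationOperands
      (hT.comp (fst.comp fst)) (he.comp (fst.comp fst)) (hα.comp (fst.comp (fst.comp fst)) snd)
      (snd.comp fst) snd))
  exact (of_equiv_symm (e := Construction.equiv)).comp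
    (.pair (.const []) (.pair (list_length.comp hlabels) (.pair hshift hentries)))

theorem primrecPred_isDominantList {T : γ → List (List ℕ)} {p : γ → List ℕ} (hT : Primrec T)
    (hp : Primrec p) : PrimrecPred fun c => IsDominantList (T c) (p c) := by
  have hlength : Primrec fun c => (T c).length := list_length.comp hT
  have hvalue : Primrec fun x : ℕ × γ => (p x.2).getD x.1 0 :=
    (list_getD 0).comp (hp.comp snd) fst
  refine primrecPred_forall_lt hlength (.and (nat_lt.comp hvalue (hlength.comp snd))
    (.and (Primrec.eq.comp (list_idxOf.comp hvalue (hp.comp snd)) fst)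
      (primrecPred_forall_lt (hlength.comp snd) ?_)))
  have hT' : Primrec fun x : ℕ × ℕ × γ => T x.2.2 := hT.comp (snd.comp snd)
  exact nat_le.comp (primrec_tableEntry hT' (fst.comp snd) fst) (nat_max.comp
    (primrec_tableEntry hT' (fst.comp snd) (hvalue.comp snd))
    (primrec_tableEntry hT' (list_idxOf.comp fst (hp.comp (snd.comp snd))) fst))

theorem computable_dominantList : Computable dominantList := by
  have hdecode : Primrec fun n : ℕ => (Encodable.decode n : Option (List ℕ)).getD [] :=
    option_getD.comp Primrec.decode (.const [])
  have hP : PrimrecPred fun x : List (List ℕ) × ℕ =>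
      IsDominantList x.1 ((Encodable.decode x.2).getD []) :=
    primrecPred_isDominantList fst (hdecode.comp snd)
  exact hdecode.to_comp.comp (Computable.find hP.computablePred exists_isDominantList_decode)

variable {T : γ → List (List ℕ)} {p : γ → List ℕ} {i : γ → ℕ}

theorem primrec_rowDegree (hT : Primrec T) (hp : Primrec p) (hi : Primrec i) :
    Primrec fun c => rowDegree (T c) (p c) (i c) :=
  primrec_tableEntry hT hi ((list_getD 0).comp hp hi)

theorem primrec_columnDegree (hT : Primrec T) (hp : Primrec p) (hi : Primrec i) :
    Primrec fun c => columnDegree (T c) (p c) (i c) :=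
  primrec_tableEntry hT (list_idxOf.comp hi hp) hi

theorem primrec_digitLength (hT : Primrec T) (hp : Primrec p) :
    Primrec fun c => digitLength (T c) (p c) :=
  Primrec.succ.comp (nat_div.comp (nat_sub.comp (primrec_sum.comp
    (list_map (g := fun c i => rowDegree (T c) (p c) i) (list_range.comp (list_length.comp hT))
      (primrec_rowDegree (hT.comp fst) (hp.comp fst) snd))) (.const 1)) (list_length.comp hT))

theorem primrec_largeShift {s : γ → List ℤ} (hT : Primrec T) (hs : Primrec s) :
    Primrec fun c => largeShift (T c) (s c) :=
  primrec_natCast_int.comp (nat_add.comp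
    (primrec_sum.comp (list_map (g := fun _ => List.sum) hT (primrec_sum.comp snd)))
    (primrec_sum.comp (list_map (g := fun _ => Int.natAbs) hs (primrec_natAbs.comp snd))))

theorem primrec_planOf {s : γ → List ℤ} (hT : Primrec T) (hs : Primrec s) (hp : Primrec p) :
    Primrec fun c => planOf (T c) (s c) (p c) :=
  have hdigits := (primrec_digitLength hT hp).comp fst
  primrec_linearizationConstruction (list_length.comp hT) hT hs (primrec_largeShift hT hs)
    (primrec_digitLength hT hp)
    (nat_div.comp (primrec_rowDegree (hT.comp fst) (hp.comp fst) snd) hdigits)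
    (nat_div.comp (primrec_columnDegree (hT.comp fst) (hp.comp fst) snd) hdigits)

theorem computable_plan : Computable plan := by
  have hplanOf : Primrec fun x : (List (List ℕ) × List ℤ) × List ℕ => planOf x.1.1 x.1.2 x.2 :=
    primrec_planOf (fst.comp fst) (snd.comp fst) snd
  have hlist : Computable fun a : List (List ℕ) × List ℤ => (a, dominantList a.1) :=
    .pair .id (computable_dominantList.comp .fst)
  exact (hplanOf.to_comp.comp hlist :)

end Computability

end PolyMat

end

theorem proposition3p2 :
    ∃ plan : List (List ℕ) × List ℤ → Construction, Computable plan ∧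
      ∀ (K : Type*) [Field K] (m : ℕ), 0 < m →
      ∀ (A : Matrix (Fin m) (Fin m) K[X]) (s : Fin m → ℤ), A.det ≠ 0 →
      ∃ c : Construction, c = plan (degreeTable A, List.ofFn s) ∧
        c.fieldOpCount = 0 ∧
        (c.matrix A).det ≠ 0 ∧
        c.dim ≤ 3 * m ∧
        matDegree (c.matrix A) ≤ ⌈(genericDetBound A : ℚ) / (m : ℚ)⌉₊ ∧
        ∃ (hm : m ≤ c.dim) (P : Matrix (Fin c.dim) (Fin c.dim) K[X]),
          (∀ Q, IsPopovFormOf c.shiftFun (c.matrix A) Q ↔ Q = P) ∧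
          (∀ Q, IsPopovFormOf s A Q ↔ Q = P.submatrix (Fin.castLE hm) (Fin.castLE hm)) := by
  refine ⟨plan, computable_plan, fun K _ m hm A s hA => ?_⟩
  obtain ⟨e, α, β, hplan, he, hcover, hdim, hδ, hextra⟩ := exists_plan_eq hm A s
  obtain ⟨hle, P, hP, hPA⟩ := exists_isPopovFormOf_linearizationConstruction hA he hcover
    (natDegree_det_add_le_largeShift A s) rfl
  exact ⟨_, hplan.symm, rfl, det_linearizationConstruction_ne_zero hA he hcover _ _, hdim,
    matDegree_linearizationConstruction_le hδ hextra _ _, hle, P, hP.iff_eq, hPA.iff_eq⟩
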